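/- Let $s\ge 0$ be a fixed integer. A word $y$ lies in the single-deletion $s$-substitution ball of $x$ if it is obtained from $x$ by exactly one deletion and exactly $s$ substitutions, in any order, where a substitution may replace a symbol by itself; a set of words of a common length is a single-deletion $s$-substitution correcting code if the balls of any two distinct codewords are disjoint. The redundancy of a binary code $\mathcal C$ of length $N$ is $N-\log|\mathcal C|$, with $\log=\log_2$. For a binary word $x=x_1\cdots x_n$ and $0\le k\le 2s$ let $$F^k(x)=\Big(\sum_{i=1}^n i^k\sum_{j=1}^i x_j\Big) \bmod \Big((2s+1)\sum_{i=1}^n i^k+1\Big),$$ let $F_b^k(x)$ be the binary representation of $F^k(x)$ with the fixed number $\big\lceil \log\big((2s+1)\sum_{i=1}^n i^k+1\big)\big\rceil$ of digits, and let $F_b(x)=\big(F_b^0(x),F_b^1(x),\ldots,F_b^{2s}(x)\big)$ be the concatenation of these words. Let $R_{2s+2}$ repeat every symbol of a word $2s+2$ times, and put $$\mathcal E(x)=\big(x,\;F_b(x),\;R_{2s+2}(F_b(F_b(x)))\big),\qquad \mathcal C_n=\{\mathcal E(x): x\in\{0,1\}^n\}.$$ Theorem. For every $n$, all words of $\mathcal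 C_n$ have the same length, and $\mathcal C_n$ is a binary single-deletion $s$-substitution correcting code. As $n\to\infty$, its redundancy is $(s+1)(2s+1)\log n+O(\log\log n)$. Moreover, on a word RAM with words of $O(\log n)$ bits and unit-cost instructions (addition, truncated subtraction, multiplication, division, remainder, comparison, and indirect memory access): 1. there is a program that, for all $n\ge 1$ and $x\in\{0,1\}^n$, computes $\mathcal E(x)$ from $x$ in $O(n)$ steps; 2. there is a program that, for all $n\ge 1$, all $x\in\{0,1\}^n$ and every $y$ in the single-deletion $s$-substitution ball of $\mathcal E(x)$, computes $x$ from $n$ and $y$ in $O(n^{s+2})$ steps. The programs and the implied constants depend on $s$ only. -/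

import Mathlib

/-! ### Deletion/substitution balls, codes and redundancy -/

namespace DelSub

/-- `Reach t s x y`: the word `y` is obtained from the word `x` by exactly `t` deletions and exactly
`s` substitutions, performed in some order. A substitution may be trivial (it may replace a symbol
by itself). -/
inductive Reach {α : Type*} : ℕ → ℕ → List α → List α → Prop
  | refl (x : List α) : Reach 0 0 x x
  | deletion {t s : ℕ} {x y : List α} (h : Reach t s x y) (i : ℕ) (hi : i < y.length) :
      Reach (t + 1) s x (y.eraseIdx i)
  | substitution {t s : ℕ} {x y : List α} (h : Reach t s x y) (i : ℕ) (hi : i < y.length) (a : α) :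
      Reach t (s + 1) x (y.set i a)

/-- The `t`-deletion `s`-substitution ball of `x`. -/
def ball {α : Type*} (t s : ℕ) (x : List α) : Set (List α) := {y | Reach t s x y}

/-- `C` is a `t`-deletion `s`-substitution correcting code: the `t`-deletion `s`-substitution balls
of any two distinct codewords are disjoint. -/
def IsCorrecting {α : Type*} (t s : ℕ) (C : Set (List α)) : Prop :=
  ∀ x ∈ C, ∀ y ∈ C, x ≠ y → Disjoint (ball t s x) (ball t s y)

/-- The redundancy, in bits, of a `q`-ary code `C` of length `N`. -/
noncomputable def redundancy {α : Type*} (q N : ℕ) (C : Set (List α)) : ℝ :=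
  N * Real.logb 2 q - Real.logb 2 C.ncard

/-! ### The encoder -/

/-- The accumulative sequence of a binary word: its `i`-th entry (`i = 1, …, n`) is
`x₁ + ⋯ + xᵢ`. -/
def accum (x : List Bool) : List ℕ :=
  (List.range x.length).map fun i => ((x.take (i + 1)).map Bool.toNat).sum

/-- The `k`-th order VT syndrome `∑ i = 1, …, n, iᵏ zᵢ` of a sequence `z` (list positions start
at `0`). -/
def VT {R : Type*} [CommSemiring R] (k : ℕ) (z : List R) : R :=
  ∑ i ∈ Finset.range z.length, ((i + 1 : ℕ) : R) ^ k * z.getD i 0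

/-- The modulus `(2 s + 1) ∑ i = 1, …, n, iᵏ + 1`. -/
def modulus (s k n : ℕ) : ℕ := (2 * s + 1) * ∑ i ∈ Finset.Icc 1 n, i ^ k + 1

/-- `Fᵏ(x)`, the `k`-th order VT syndrome of the accumulative sequence of `x`, reduced modulo
`modulus s k |x|`. -/
def F (s k : ℕ) (x : List Bool) : ℕ := VT k (accum x) % modulus s k x.length

/-- The binary representation of `m` with `w` digits, most significant digit first. -/
def binary (w m : ℕ) : List Bool := (List.range w).reverse.map fun j => m.testBit j

/-- The binary representation of `Fᵏ(x)`; its number of digits `⌈log₂ (modulus s k |x|)⌉` is the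
least one in which all residues can be written, so it depends on the length of `x` only. -/
def Fbk (s k : ℕ) (x : List Bool) : List Bool :=
  binary (Nat.clog 2 (modulus s k x.length)) (F s k x)

/-- The concatenation of the binary representations of `F⁰(x), F¹(x), …, F²ˢ(x)`. -/
def Fb (s : ℕ) (x : List Bool) : List Bool :=
  (List.range (2 * s + 1)).flatMap fun k => Fbk s k x

/-- The encoding function of the `r`-fold repetition code: every symbol is repeated `r` times. -/
def repetition {α : Type*} (r : ℕ) (x : List α) : List α := x.flatMap fun a => List.replicate r a

/-- The systematic encoder. -/
def encode (s : ℕ) (x : List Bool) : List Bool :=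
  x ++ Fb s x ++ repetition (2 * s + 2) (Fb s (Fb s x))

/-- The code of all encodings of the binary words of length `n`. -/
def code (s n : ℕ) : Set (List Bool) := {c | ∃ x : List Bool, x.length = n ∧ encode s x = c}

end DelSub

/-! ### The word RAM

A machine with registers `R[0], R[1], …` and a random access memory `M[0], M[1], …`, all holding
words of `w` bits, i.e. natural numbers below `2 ^ w`. Every elementary instruction and every test
takes one step. An instruction whose result does not fit in a word cannot be executed, so a
computation that overflows never counts as a halting one. -/

namespace WordRAM

/-- A configuration: the contents of the registers and of the memory. -/
structure State where
  reg : ℕ → ℕ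
  mem : ℕ → ℕ

/-- The arithmetic operations. Subtraction is truncated at `0`. -/
inductive BinOp
  | add | sub | mul | div | mod

def BinOp.eval : BinOp → ℕ → ℕ → ℕ
  | .add, a, b => a + b
  | .sub, a, b => a - b
  | .mul, a, b => a * b
  | .div, a, b => a / b
  | .mod, a, b => a % b

/-- Elementary instructions: `R[d] := v`, `R[d] := R[a] ∘ R[b]`, `R[d] := M[R[a]]` and
`M[R[a]] := R[b]`. -/
inductive Instr
  | const (d v : ℕ)
  | arith (o : BinOp) (d a b : ℕ)
  | load (d a : ℕ)
  | store (a b : ℕ)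

/-- The number that an instruction writes. -/
def Instr.value (σ : State) : Instr → ℕ
  | .const _ v => v
  | .arith o _ a b => o.eval (σ.reg a) (σ.reg b)
  | .load _ a => σ.mem (σ.reg a)
  | .store _ b => σ.reg b

/-- The configuration after an instruction. -/
def Instr.apply (σ : State) (i : Instr) : State :=
  match i with
  | .const d _ => { σ with reg := Function.update σ.reg d (i.value σ) }
  | .arith _ d _ _ => { σ with reg := Function.update σ.reg d (i.value σ) }
  | .load d _ => { σ with reg := Function.update σ.reg d (i.value σ) }
  | .store a _ => { σ with mem := Function.update σ.mem (σ.reg a) (i.value σ) }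

/-- Programs; the tests of `ifLt a b` and `whileLt a b` are `R[a] < R[b]`. -/
inductive Program
  | skip
  | instr (i : Instr)
  | seq (p q : Program)
  | ifLt (a b : ℕ) (p q : Program)
  | whileLt (a b : ℕ) (p : Program)

/-- `Exec w p σ t τ`: with words of `w` bits, the program `p` started in the configuration `σ` halts
after exactly `t` steps in the configuration `τ`. -/
inductive Exec (w : ℕ) : Program → State → ℕ → State → Prop
  | skip (σ : State) : Exec w .skip σ 1 σ
  | instr (i : Instr) (σ : State) (h : i.value σ < 2 ^ w) : Exec w (.instr i) σ 1 (i.apply σ)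
  | seq {p q : Program} {σ τ υ : State} {t u : ℕ} (hp : Exec w p σ t τ) (hq : Exec w q τ u υ) :
      Exec w (.seq p q) σ (t + u) υ
  | ifTrue {a b : ℕ} {p q : Program} {σ τ : State} {t : ℕ} (h : σ.reg a < σ.reg b)
      (hp : Exec w p σ t τ) : Exec w (.ifLt a b p q) σ (t + 1) τ
  | ifFalse {a b : ℕ} {p q : Program} {σ τ : State} {t : ℕ} (h : ¬ σ.reg a < σ.reg b)
      (hq : Exec w q σ t τ) : Exec w (.ifLt a b p q) σ (t + 1) τ
  | whileTrue {a b : ℕ} {p : Program} {σ τ υ : State} {t u : ℕ} (h : σ.reg a < σ.reg b)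
      (hp : Exec w p σ t τ) (hr : Exec w (.whileLt a b p) τ u υ) :
      Exec w (.whileLt a b p) σ (t + u + 1) υ
  | whileFalse {a b : ℕ} {p : Program} {σ : State} (h : ¬ σ.reg a < σ.reg b) :
      Exec w (.whileLt a b p) σ 1 σ

/-- The initial configuration on the parameter `n` and the binary input word `u`: the bits of `u`
are in `M[0], M[1], …`, the length of `u` is in `R[0]`, `n` is in `R[1]`, and everything else
is `0`. -/
def init (n : ℕ) (u : List Bool) : State where
  reg := fun i => if i = 0 then u.length else if i = 1 then n else 0
  mem := fun i => (u.getD i false).toNat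

/-- The binary word `v` is the output held by a final configuration: its length is in `R[0]` and its
bits are in `M[0], M[1], …`. -/
def State.HasOutput (σ : State) (v : List Bool) : Prop :=
  σ.reg 0 = v.length ∧ ∀ (i : ℕ) (h : i < v.length), σ.mem i = (v[i]).toNat

/-- On the parameter `n` and the input `u`, with words of `w` bits, the program `p` halts after at
most `T` steps with the output `v`. -/
def RunsIn (p : Program) (w n : ℕ) (u v : List Bool) (T : ℕ) : Prop :=
  n < 2 ^ w ∧ u.length < 2 ^ w ∧
    ∃ t ≤ T, ∃ σ : State, Exec w p (init n u) t σ ∧ σ.HasOutput v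

end WordRAM

namespace DelSub

/-! ### Words with few sign changes and vanishing moments -/

/-! The code corrects errors because a word is determined by its syndromes together with any
received word. Suppose `x` and `x'` both become `y` after one deletion each, up to at most `s` wrong
places (`Near`). Then the two shortened words differ in at most `2 s` places. `accum_diff` shows
that the difference `u` of the accumulative sequences is bounded by `2 s + 1` and changes sign at
most `2 s` times: apart from a correction of fixed sign, it is a partial sum of the differences of
the shortened words.

The bound makes every moment of `u` of order `k ≤ 2 s` smaller in absolute value than the modulus of
`Fᵏ`, so equality of the residues forces these moments to vanish. `eq_zero_of_moments` pairs `u`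
with a polynomial of degree at most `2 s` that has its roots at the sign changes. The resulting sum
vanishes and its terms have one sign, hence `u = 0`. This gives `Near.unique`.

The parts of a codeword are recovered from right to left. A window of the received word belonging to
one part is `Near` that part (`Near.parts`). Blocks of `2 s + 2` equal symbols survive a shift by
one and `s` errors by majority (`Near.repetition_unique`), which yields `Fb s (Fb s x)`; then
`Near.unique` yields `Fb s x`, and a second use yields `x`.

The syndrome of order `k` has `(k + 1) log n + O(1)` bits, and these sum to `(s + 1) (2 s + 1) log n
+ O(1)`. The syndromes of this word of logarithmic length take `O(log log n)` bits, repeated a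
constant number of times (`redundancy_isBigO`).

For the running times, programs over arithmetic expressions are compiled to the machine
(`Expr.exec_compile`) and analysed by the timed Hoare triples `Runs`. All values stay below a fixed
power of a linear function of `n`, so words of `O(log n)` bits suffice. Syndromes take linear time.
The decoder runs through `O(n ^ (s + 1))` candidates, which include every word `Near` a given one
(`Near.exists_candidate_eq`) and only such words (`near_candidate`), and compares their syndromes in
`O(n)` steps each. -/

open Finset in
/-- A sequence of integers whose signs change at most `q` times and whose moments of order `0, …, q`
vanish is zero. -/
theorem eq_zero_of_moments {n q : ℕ} {u σ : ℕ → ℤ} (hσ : ∀ i, σ i = 1 ∨ σ i = -1)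
    (hu : ∀ i < n, 0 ≤ σ i * u i) (hc : #{i ∈ range (n - 1) | σ i ≠ σ (i + 1)} ≤ q)
    (hm : ∀ k ≤ q, ∑ i ∈ range n, ((i : ℤ) + 1) ^ k * u i = 0) : ∀ i < n, u i = 0 := by
  set S := {i ∈ range (n - 1) | σ i ≠ σ (i + 1)} with hS
  -- The entry `u i` is paired with the point `i + 1`, so a sign change between `i = c` and `i = c +
  -- 1` is matched by a root at `c + 3 / 2`. The factor 2 keeps the coefficients integral.
  let P : Polynomial ℤ := ∏ c ∈ S, (Polynomial.C 2 * Polynomial.X - Polynomial.C (2 * (c : ℤ) + 3))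
  have hdeg : P.natDegree ≤ q := by
    refine (Polynomial.natDegree_prod_le _ _).trans 
      (le_trans (sum_le_card_nsmul _ _ 1 ?_) (by simpa))
    intro c _
    compute_degree
  have heval (t : ℤ) : P.eval t = ∏ c ∈ S, (2 * t - (2 * (c : ℤ) + 3)) := by
    simp [P, Polynomial.eval_prod]
  have hzero : ∑ i ∈ range n, P.eval ((i : ℤ) + 1) * u i = 0 := by
    simp_rw [Polynomial.eval_eq_sum_range, sum_mul]
    rw [sum_comm]
    refine sum_eq_zero fun k hk => ?_
    simp_rw [mul_assoc]
    rw [← mul_sum, hm k (by simp at hk; omega), mul_zero]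
  have hne (i : ℕ) : P.eval ((i : ℤ) + 1) ≠ 0 := by
    rw [heval, prod_ne_zero_iff]
    intro c _ h
    omega
  have hstep (i : ℕ) (hi : i + 1 < n) :
      0 < (σ i * P.eval ((i : ℤ) + 1)) * (σ (i + 1) * P.eval (((i + 1 : ℕ) : ℤ) + 1)) := by
    -- The factor of `c` contributes `(2 (i - c) - 1) (2 (i - c) + 1)`, which is negative only for
    -- `c = i`. Hence `P` changes sign exactly where `σ` does.
    have hprod : P.eval ((i : ℤ) + 1) * P.eval (((i + 1 : ℕ) : ℤ) + 1)
        = ∏ c ∈ S, (4 * ((i : ℤ) - c) ^ 2 - 1) := by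
      rw [heval, heval, ← prod_mul_distrib]
      refine prod_congr rfl fun c _ => ?_
      push_cast; ring
    have hpos (c : ℕ) (h : c ≠ i) : 0 < 4 * ((i : ℤ) - c) ^ 2 - 1 := by
      have : 1 ≤ ((i : ℤ) - c) ^ 2 := by
        have : ((i : ℤ) - c) ≠ 0 := by omega
        have := sq_pos_of_ne_zero this
        omega
      omega
    rw [mul_mul_mul_comm, hprod]
    by_cases h : σ i = σ (i + 1)
    · refine mul_pos ?_ (prod_pos fun c hcS => hpos c ?_)
      · rw [h]; rcases hσ (i + 1) with h | h <;> simp [h]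
      · rintro rfl
        simp [hS] at hcS
        exact hcS.2 h
    · have hiS : i ∈ S := by simp [hS, h]; omega
      rw [← mul_prod_erase _ _ hiS]
      have h1 : σ i * σ (i + 1) = -1 := by
        rcases hσ i with h1 | h1 <;> rcases hσ (i + 1) with h2 | h2 <;> simp_all
      have h2 : 0 < ∏ c ∈ S.erase i, (4 * ((i : ℤ) - c) ^ 2 - 1) :=
        prod_pos fun c hc => hpos c (ne_of_mem_erase hc)
      rw [h1]
      simpa using h2
  obtain ⟨τ, hτ, hsign⟩ : ∃ τ : ℤ, τ ≠ 0 ∧ ∀ i < n, 0 < τ * (σ i * P.eval ((i : ℤ) + 1)) := by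
    refine ⟨σ 0 * P.eval (((0 : ℕ) : ℤ) + 1), mul_ne_zero ?_ (hne 0), fun i => ?_⟩
    · rcases hσ 0 with h | h <;> simp [h]
    induction i with
    | zero =>
      intro _
      refine mul_self_pos.2 (mul_ne_zero ?_ (hne 0))
      rcases hσ 0 with h | h <;> simp [h]
    | succ i ih =>
      intro hi
      have h1 := mul_pos (ih (by omega)) (hstep i hi)
      have h2 : 0 < (σ i * P.eval ((i : ℤ) + 1)) ^ 2 :=
        sq_pos_of_ne_zero (mul_ne_zero (by rcases hσ i with h | h <;> simp [h]) (hne i))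
      -- The product of the two known positive numbers contains the value at `i` twice; this square
      -- is cancelled.
      refine pos_of_mul_pos_left (b := (σ i * P.eval ((i : ℤ) + 1)) ^ 2) ?_ h2.le
      convert h1 using 1; ring
  have hterm : ∀ i ∈ range n, 0 ≤ τ * (P.eval ((i : ℤ) + 1) * u i) := by
    intro i hi
    rw [mem_range] at hi
    have h1 := mul_nonneg (hsign i hi).le (hu i hi)
    have h2 : σ i * σ i = 1 := by rcases hσ i with h | h <;> simp [h]
    calc (0 : ℤ) ≤ _ := h1
      _ = (σ i * σ i) * (τ * (P.eval ((i : ℤ) + 1) * u i)) := by ring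
      _ = _ := by rw [h2, one_mul]
  intro i hi
  have h := (sum_eq_zero_iff_of_nonneg hterm).1
    (by rw [← mul_sum, hzero, mul_zero]) i (mem_range.2 hi)
  simpa [hτ, hne i] using h

/-! ### One deletion in each of two binary words -/

/-- The position in a word of the `j`-th symbol that is left after the deletion of the `d`-th. -/
def skipIdx (d j : ℕ) : ℕ := if j < d then j else j + 1

theorem skipIdx_injective (d : ℕ) : Function.Injective (skipIdx d) := by
  intro i j h
  simp only [skipIdx] at h
  split_ifs at h <;> omega

open Finset in
theorem sum_range_skipIdx_of_le (f : ℕ → ℤ) {e m : ℕ} (h : m ≤ e) :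
    ∑ j ∈ range m, f j = ∑ j ∈ range m, f (skipIdx e j) :=
  sum_congr rfl fun j hj => by
    have := mem_range.1 hj
    rw [skipIdx, if_pos (by omega)]

open Finset in
theorem sum_range_succ_skipIdx (f : ℕ → ℤ) {e m : ℕ} (h : e ≤ m) :
    ∑ j ∈ range (m + 1), f j = f e + ∑ j ∈ range m, f (skipIdx e j) := by
  induction m, h using Nat.le_induction with
  | base => rw [sum_range_succ, sum_range_skipIdx_of_le f le_rfl, add_comm]
  | succ m hm ih =>
    rw [sum_range_succ, ih, sum_range_succ _ m, skipIdx, if_neg (by omega), add_assoc]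

open Finset in
/-- If two binary sequences agree in all but `q` places after one deletion in each of them, then the
difference of their accumulative sequences is bounded by `q + 1` and changes its sign at most `q`
times. -/
theorem accum_diff {n d e q : ℕ} {a b : ℕ → ℤ} (ha : ∀ i, a i = 0 ∨ a i = 1)
    (hb : ∀ i, b i = 0 ∨ b i = 1) (hde : d ≤ e) (he : e < n)
    (hq : #{j ∈ range (n - 1) | a (skipIdx d j) ≠ b (skipIdx e j)} ≤ q) :
    (∀ i < n, |∑ j ∈ range (i + 1), (a j - b j)| ≤ q + 1) ∧
    ∃ σ : ℕ → ℤ, (∀ i, σ i = 1 ∨ σ i = -1) ∧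
      (∀ i < n, 0 ≤ σ i * ∑ j ∈ range (i + 1), (a j - b j)) ∧
      #{i ∈ range (n - 1) | σ i ≠ σ (i + 1)} ≤ q := by
  set S := {j ∈ range (n - 1) | a (skipIdx d j) ≠ b (skipIdx e j)} with hS
  let w : ℕ → ℤ := fun m => ∑ j ∈ range m, (a (skipIdx d j) - b (skipIdx e j))
  -- Once position `e` has been passed, both full words contain their deleted symbol, so only `i`
  -- symbols of the shortened words have been read. Before `e`, the shortened words are compared one
  -- symbol further, and the excess symbol of `a` is put into the correction below.
  let W : ℕ → ℤ := fun i => w (if i < e then i + 1 else i)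
  have hw (m : ℕ) (hm : m ≤ n - 1) : |w m| ≤ q := by
    calc |w m| ≤ ∑ j ∈ range m, |a (skipIdx d j) - b (skipIdx e j)| := abs_sum_le_sum_abs _ _
      _ ≤ ∑ j ∈ range (n - 1), |a (skipIdx d j) - b (skipIdx e j)| :=
          sum_le_sum_of_subset_of_nonneg (range_mono hm) fun _ _ _ => abs_nonneg _
      _ ≤ ∑ j ∈ range (n - 1), if a (skipIdx d j) ≠ b (skipIdx e j) then 1 else 0 := by
          refine sum_le_sum fun j _ => ?_
          rcases ha (skipIdx d j) with h1 | h1 <;> rcases hb (skipIdx e j) with h2 | h2 <;>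
            simp [h1, h2]
      _ = #S := by rw [sum_boole]
      _ ≤ q := by exact_mod_cast hq
  have hW (i : ℕ) (hi : i < n) : |W i| ≤ q := hw _ (by split_ifs <;> omega)
  have hsucc (m : ℕ) : w (m + 1) = w m + (a (skipIdx d m) - b (skipIdx e m)) := sum_range_succ _ _
  have hu (i : ℕ) : ∑ j ∈ range (i + 1), (a j - b j) =
      W i + if i < d then 0 else if i < e then a d - a (skipIdx d i) else a d - b e := by
    rw [sum_sub_distrib]
    by_cases h1 : i < d
    · rw [sum_range_skipIdx_of_le a (by omega : i + 1 ≤ d),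
        sum_range_skipIdx_of_le b (by omega : i + 1 ≤ e)]
      simp only [W, w, h1, if_true, if_pos (by omega : i < e), sum_sub_distrib]
      ring
    · by_cases h2 : i < e
      · rw [sum_range_succ_skipIdx a (by omega : d ≤ i),
          sum_range_skipIdx_of_le b (by omega : i + 1 ≤ e)]
        simp only [W, w, h1, h2, if_true, if_false, sum_sub_distrib, sum_range_succ]
        ring
      · rw [sum_range_succ_skipIdx a (by omega : d ≤ i),
          sum_range_succ_skipIdx b (by omega : e ≤ i)]
        simp only [W, w, h1, h2, if_false, sum_sub_distrib]
        ring
  -- A change of `W` reads exactly one place of the shortened words, which must be a mismatch. At `i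
  -- + 1 = e` the value of `W` stays the same; leaving this index out makes the map of places
  -- injective.
  have hchange {σ : ℕ → ℤ} (h : ∀ i, W i = W (i + 1) → σ i = σ (i + 1)) :
      #{i ∈ range (n - 1) | σ i ≠ σ (i + 1)} ≤ q := by
    refine le_trans (card_le_card_of_injOn (fun i => if i + 1 < e then i + 1 else i) ?_ ?_) hq
    · intro i hi
      simp only [coe_filter, mem_range, Set.mem_ofPred_eq] at hi
      have h3 : W i ≠ W (i + 1) := fun h' => hi.2 (h i h')
      simp only [hS, coe_filter, mem_range, Set.mem_ofPred_eq]
      simp only [W] at h3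
      split_ifs at h3 ⊢ with h4 h5 <;> try omega
      · refine ⟨by omega, fun h6 => h3 ?_⟩
        rw [hsucc (i + 1), h6]; ring
      · refine ⟨by omega, fun h6 => h3 ?_⟩
        rw [hsucc i, h6]; ring
    · intro i hi j hj hij
      simp only [coe_filter, mem_range, Set.mem_ofPred_eq] at hi hj
      have key (i : ℕ) (hi : σ i ≠ σ (i + 1)) : i + 1 ≠ e := by
        intro h'
        refine hi (h i ?_)
        simp only [W]
        rw [if_pos (by omega), if_neg (by omega)]
      have h1 := key i hi.2
      have h2 := key j hj.2
      dsimp only at hij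
      split_ifs at hij <;> omega
  have habs (i : ℕ) (hi : i < n) := abs_le.1 (hW i hi)
  constructor
  · intro i hi
    have := habs i hi
    rw [hu i, abs_le]
    split_ifs
    · constructor <;> linarith
    · rcases ha d with h1 | h1 <;> rcases ha (skipIdx d i) with h2 | h2 <;> rw [h1, h2] <;>
        constructor <;> linarith
    · rcases ha d with h1 | h1 <;> rcases hb e with h2 | h2 <;> rw [h1, h2] <;>
        constructor <;> linarith
  -- The correction in `hu` lies in `{-1, 0}` if `a d = 0` and in `{0, 1}` if `a d = 1`. So the sign
  -- of `W`, with zero counted as negative in the first case and as positive in the second, is a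
  -- valid sign for the full sum.
  · rcases ha d with had | had
    · refine ⟨fun i => if 0 < W i then 1 else -1, fun i => ?_, fun i hi => ?_, ?_⟩
      · dsimp only; split_ifs <;> simp
      · have h2 := ha (skipIdx d i)
        have h3 := hb e
        dsimp only
        rw [hu i, had]
        split_ifs <;> omega
      · exact hchange fun i h => by simp only [h]
    · refine ⟨fun i => if 0 ≤ W i then 1 else -1, fun i => ?_, fun i hi => ?_, ?_⟩
      · dsimp only; split_ifs <;> simp
      · have h2 := ha (skipIdx d i)
        have h3 := hb e
        dsimp only
        rw [hu i, had]
        split_ifs <;> omega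
      · exact hchange fun i h => by simp only [h]

/-! ### Words in a common ball -/

/-- The `j`-th bit of a word; it is `0` if the word is too short. -/
def bitAt (x : List Bool) (j : ℕ) : ℕ := (x.getD j false).toNat

theorem bitAt_le_one (x : List Bool) (j : ℕ) : bitAt x j ≤ 1 := Bool.toNat_le _

theorem bitAt_cons_zero (b : Bool) (x : List Bool) : bitAt (b :: x) 0 = b.toNat := by
  simp [bitAt]

theorem bitAt_cons_succ (b : Bool) (x : List Bool) (j : ℕ) :
    bitAt (b :: x) (j + 1) = bitAt x j := by
  simp [bitAt]

theorem bitAt_eq_iff {x y : List Bool} {i j : ℕ} (hi : i < x.length) (hj : j < y.length) :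
    bitAt x i = bitAt y j ↔ x[i]? = y[j]? := by
  simp only [bitAt, List.getD_eq_getElem?_getD, List.getElem?_eq_getElem hi,
    List.getElem?_eq_getElem hj, Option.getD_some, Option.some.injEq]
  cases x[i] <;> cases y[j] <;> simp

theorem ext_bitAt {x y : List Bool} (h : x.length = y.length)
    (hb : ∀ i < x.length, bitAt x i = bitAt y i) : x = y := by
  refine List.ext_getElem? fun i => ?_
  by_cases hi : i < x.length
  · exact (bitAt_eq_iff hi (h ▸ hi)).1 (hb i hi)
  · rw [List.getElem?_eq_none (by omega), List.getElem?_eq_none (by omega)]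

open Finset in
theorem sum_map_take (x : List Bool) (m : ℕ) :
    ((x.take m).map Bool.toNat).sum = ∑ j ∈ range m, bitAt x j := by
  induction x generalizing m with
  | nil => simp [bitAt]
  | cons b x ih =>
    cases m with
    | zero => simp
    | succ m =>
      rw [sum_range_succ', List.take_succ_cons, List.map_cons, List.sum_cons, ih, bitAt_cons_zero,
        add_comm]
      simp only [bitAt_cons_succ]

open Finset in
theorem VT_accum (k : ℕ) (x : List Bool) :
    VT k (accum x) = ∑ i ∈ range x.length, (i + 1) ^ k * ∑ j ∈ range (i + 1), bitAt x j := by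
  have hlen : (accum x).length = x.length := by simp [accum]
  rw [VT, hlen]
  refine sum_congr rfl fun i hi => ?_
  rw [mem_range] at hi
  rw [← sum_map_take]
  simp [accum, List.getD_eq_getElem?_getD, hi]

/-- The places where `y` differs from the word that is left of `x` after the deletion of its `d`-th
symbol. -/
def mismatches (d : ℕ) (x y : List Bool) : Finset ℕ :=
  {j ∈ Finset.range y.length | y[j]? ≠ x[skipIdx d j]?}

/-- After some deletion in `x`, the words `x` and `y` agree in all but `s` places. -/
def Near (s : ℕ) (x y : List Bool) : Prop :=
  y.length + 1 = x.length ∧ ∃ d < x.length, (mismatches d x y).card ≤ s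

-- The order of the operations does not matter: a substitution creates at most one new mismatch, at
-- its own position, and a deletion carries the remaining places injectively back to old ones.
open Finset in
theorem Reach.near_aux {t s : ℕ} {x y : List Bool} (h : Reach t s x y) :
    (t = 0 → y.length = x.length ∧ #{j ∈ range y.length | y[j]? ≠ x[j]?} ≤ s) ∧
      (t = 1 → Near s x y) := by
  induction h with
  | refl => simp
  | @deletion t s x y h i hi ih =>
    refine ⟨by simp, fun ht => ?_⟩
    obtain ⟨h1, h2⟩ := ih.1 (by omega)
    have hlen : (y.eraseIdx i).length = y.length - 1 := List.length_eraseIdx_of_lt hi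
    refine ⟨by omega, i, by omega, le_trans (card_le_card_of_injOn (skipIdx i) ?_
      (skipIdx_injective i).injOn) h2⟩
    intro j hj
    simp only [mismatches, coe_filter, mem_range, Set.mem_ofPred_eq, hlen] at hj ⊢
    have h3 : (y.eraseIdx i)[j]? = y[skipIdx i j]? := by
      rw [List.getElem?_eraseIdx, skipIdx]; split_ifs <;> rfl
    exact ⟨by unfold skipIdx; split_ifs <;> omega, h3 ▸ hj.2⟩
  | @substitution t s x y h i hi a ih =>
    constructor
    · intro ht
      obtain ⟨h1, h2⟩ := ih.1 ht
      refine ⟨by simpa using h1, (card_le_card (t := insert i {j ∈ range y.length | y[j]? ≠ x[j]?})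
        ?_).trans ((card_insert_le _ _).trans (by omega))⟩
      intro j hj
      by_cases hji : j = i
      · simp [hji]
      · simpa [hji, List.getElem?_set, Ne.symm hji] using hj
    · intro ht
      obtain ⟨h1, d, hd, h2⟩ := ih.2 ht
      refine ⟨by simpa using h1, d, hd, (card_le_card (t := insert i (mismatches d x y))
        ?_).trans ((card_insert_le _ _).trans (by omega))⟩
      intro j hj
      by_cases hji : j = i
      · simp [hji]
      · simpa [mismatches, hji, List.getElem?_set, Ne.symm hji] using hj

theorem near_of_mem_ball {s : ℕ} {x y : List Bool} (h : y ∈ ball 1 s x) : Near s x y :=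
  (Reach.near_aux h).2 rfl

-- If the deletion hits `v`, the window still lacks the last symbol of `u`, as if that one had been
-- deleted. This is the reason for the minimum in the witness.
open Finset in
theorem Near.append_left {s : ℕ} {u v y : List Bool} (h : Near s (u ++ v) y) (hu : 0 < u.length) :
    Near s u (y.take (u.length - 1)) := by
  obtain ⟨h1, d, hd, h2⟩ := h
  simp only [List.length_append] at h1 hd
  have hlen : (y.take (u.length - 1)).length = u.length - 1 := by simp; omega
  refine ⟨by omega, min d (u.length - 1), by omega, (card_le_card ?_).trans h2⟩
  intro j hj
  simp only [mismatches, mem_filter, mem_range, hlen] at hj ⊢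
  obtain ⟨hj1, hj2⟩ := hj
  refine ⟨by omega, ?_⟩
  rw [List.getElem?_take, if_pos hj1] at hj2
  have h3 : skipIdx d j = skipIdx (min d (u.length - 1)) j := by
    unfold skipIdx; split_ifs <;> omega
  have h4 : skipIdx d j < u.length := by unfold skipIdx; split_ifs <;> omega
  rw [List.getElem?_append_left h4, h3]
  exact hj2

-- If the deletion hits `u`, the window starts one symbol late, as if the first symbol of `v` had
-- been deleted. The truncated difference `d - u.length` covers both cases.
open Finset in
theorem Near.append_right {s : ℕ} {u v y : List Bool} (h : Near s (u ++ v) y) (hv : 0 < v.length) :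
    Near s v (y.drop u.length) := by
  obtain ⟨h1, d, hd, h2⟩ := h
  simp only [List.length_append] at h1 hd
  have hlen : (y.drop u.length).length = v.length - 1 := by simp; omega
  refine ⟨by omega, d - u.length, by omega,
    (card_le_card_of_injOn (fun j => u.length + j) ?_ (add_right_injective _).injOn).trans h2⟩
  intro j hj
  simp only [mismatches, coe_filter, mem_range, Set.mem_ofPred_eq, hlen] at hj ⊢
  obtain ⟨hj1, hj2⟩ := hj
  refine ⟨by omega, ?_⟩
  rw [List.getElem?_drop] at hj2
  have h3 : skipIdx d (u.length + j) = u.length + skipIdx (d - u.length) j := by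
    unfold skipIdx; split_ifs <;> omega
  rw [h3, List.getElem?_append_right (by omega), Nat.add_sub_cancel_left]
  exact hj2

theorem length_repetition (r : ℕ) (z : List Bool) : (repetition r z).length = r * z.length := by
  simp [repetition, mul_comm]

theorem getElem?_repetition {r : ℕ} (z : List Bool) (j : ℕ) {t : ℕ} (ht : t < r) :
    (repetition r z)[r * j + t]? = z[j]? := by
  induction z generalizing j with
  | nil => simp [repetition]
  | cons a z ih =>
    have hcons : repetition r (a :: z) = List.replicate r a ++ repetition r z := by
      simp [repetition]
    rw [hcons]
    cases j with
    | zero => rw [List.getElem?_append_left (by simpa)]; simp [ht]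
    | succ j =>
      have : r * (j + 1) + t = r + (r * j + t) := by ring
      rw [List.getElem?_append_right (by simp; nlinarith), List.length_replicate, this,
        Nat.add_sub_cancel_left, ih]
      simp

open Finset in
/-- Most of the first `2 s + 1` symbols of a block are correct. -/
theorem Near.repetition_block {s : ℕ} {z y : List Bool} (h : Near s (repetition (2 * s + 2) z) y)
    {j : ℕ} (hj : j < z.length) :
    #{t ∈ range (2 * s + 1) | y[(2 * s + 2) * j + t]? ≠ z[j]?} ≤ s := by
  obtain ⟨h1, d, hd, h2⟩ := h
  rw [length_repetition] at h1 hd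
  have hle : (2 * s + 2) * (j + 1) ≤ (2 * s + 2) * z.length := Nat.mul_le_mul_left _ hj
  rw [mul_add] at hle
  refine (card_le_card_of_injOn (fun t => (2 * s + 2) * j + t) ?_
    (add_right_injective _).injOn).trans h2
  intro t ht
  simp only [mismatches, coe_filter, mem_range, Set.mem_ofPred_eq] at ht ⊢
  obtain ⟨ht1, ht2⟩ := ht
  refine ⟨by omega, ?_⟩
  -- The deletion shifts by at most one, and `t ≤ 2 s`, so the source is still in the block of
  -- length `2 s + 2`.
  obtain ⟨t', ht', h3⟩ : ∃ t' < 2 * s + 2,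
      skipIdx d ((2 * s + 2) * j + t) = (2 * s + 2) * j + t' := by
    unfold skipIdx
    split_ifs
    · exact ⟨t, by omega, rfl⟩
    · exact ⟨t + 1, by omega, rfl⟩
  rw [h3, getElem?_repetition _ _ ht']
  exact ht2

-- Two different symbols cannot both be right at the same place, yet two sets of at most `s` wrong
-- places cannot cover `2 s + 1` places.
open Finset in
theorem Near.repetition_unique {s : ℕ} {z z' y : List Bool}
    (h : Near s (repetition (2 * s + 2) z) y) (h' : Near s (repetition (2 * s + 2) z') y)
    (hlen : z.length = z'.length) : z = z' := by
  refine List.ext_getElem? fun j => ?_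
  by_cases hj : j < z.length
  · have h1 := h.repetition_block hj
    have h2 := h'.repetition_block (hlen ▸ hj : j < z'.length)
    by_contra hne
    have h3 : #(range (2 * s + 1)) ≤ #({t ∈ range (2 * s + 1) | y[(2 * s + 2) * j + t]? ≠ z[j]?} ∪
        {t ∈ range (2 * s + 1) | y[(2 * s + 2) * j + t]? ≠ z'[j]?}) := by
      refine card_le_card fun t ht => ?_
      simp only [mem_union, mem_filter, ht, true_and]
      by_contra! h4
      exact hne (h4.1.symm.trans h4.2)
    have h4 := card_union_le {t ∈ range (2 * s + 1) | y[(2 * s + 2) * j + t]? ≠ z[j]?}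
        {t ∈ range (2 * s + 1) | y[(2 * s + 2) * j + t]? ≠ z'[j]?}
    rw [card_range] at h3
    omega
  · rw [List.getElem?_eq_none (by omega), List.getElem?_eq_none (by omega)]

/-! ### The syndromes determine a word in a given ball -/

theorem length_binary (w m : ℕ) : (binary w m).length = w := by simp [binary]

theorem bitAt_binary {w m j : ℕ} (hj : j < w) : bitAt (binary w m) (w - 1 - j) = m / 2 ^ j % 2 := by
  have h1 : w - 1 - j < w := by omega
  have h2 : w - 1 - (w - 1 - j) = j := by omega
  simp only [bitAt, binary, List.getD_eq_getElem?_getD, List.getElem?_map,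
    List.getElem?_reverse (l := List.range w) (by simpa using h1), List.length_range, h2]
  rw [List.getElem?_range hj]
  simp [Nat.toNat_testBit]

theorem binary_injOn {w m m' : ℕ} (hm : m < 2 ^ w) (hm' : m' < 2 ^ w)
    (h : binary w m = binary w m') : m = m' := by
  refine Nat.eq_of_testBit_eq fun j => ?_
  by_cases hj : j < w
  · have h1 := bitAt_binary (m := m) hj
    rw [h, bitAt_binary hj, ← Nat.toNat_testBit, ← Nat.toNat_testBit] at h1
    revert h1
    cases m.testBit j <;> cases m'.testBit j <;> simp
  · have : 2 ^ w ≤ 2 ^ j := Nat.pow_le_pow_right (by norm_num) (by omega)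
    rw [Nat.testBit_lt_two_pow (by omega), Nat.testBit_lt_two_pow (by omega)]

theorem F_lt (s k : ℕ) (x : List Bool) : F s k x < modulus s k x.length :=
  Nat.mod_lt _ (by simp [modulus])

theorem F_lt_two_pow (s k : ℕ) (x : List Bool) :
    F s k x < 2 ^ Nat.clog 2 (modulus s k x.length) :=
  (F_lt s k x).trans_le (Nat.le_pow_clog (by norm_num) _)

theorem length_Fbk (s k : ℕ) (x : List Bool) :
    (Fbk s k x).length = Nat.clog 2 (modulus s k x.length) := length_binary _ _

/-- The number of bits of all syndromes of a word of length `n`. -/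
def syndromeLength (s n : ℕ) : ℕ :=
  ∑ k ∈ Finset.range (2 * s + 1), Nat.clog 2 (modulus s k n)

theorem length_flatMap_range (f : ℕ → List Bool) (m : ℕ) :
    ((List.range m).flatMap f).length = ∑ k ∈ Finset.range m, (f k).length := by
  induction m with
  | zero => simp
  | succ m ih => rw [List.range_succ, List.flatMap_append, List.length_append, ih,
      Finset.sum_range_succ]; simp

theorem length_Fb (s : ℕ) (x : List Bool) : (Fb s x).length = syndromeLength s x.length := by
  simp only [Fb, length_flatMap_range, syndromeLength, length_Fbk]

/-- Blocks of known lengths can be split off one by one from the right. -/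
theorem flatMap_range_injOn {f g : ℕ → List Bool} {m : ℕ} (hlen : ∀ k, (f k).length = (g k).length)
    (h : (List.range m).flatMap f = (List.range m).flatMap g) : ∀ k < m, f k = g k := by
  induction m with
  | zero => simp
  | succ m ih =>
    rw [List.range_succ, List.flatMap_append, List.flatMap_append] at h
    obtain ⟨h1, h2⟩ := List.append_inj h (by simp only [length_flatMap_range, hlen])
    intro k hk
    rcases Nat.lt_succ_iff_lt_or_eq.1 hk with hk | rfl
    · exact ih h1 k hk
    · simpa using h2

theorem F_eq_of_Fb_eq {s : ℕ} {x x' : List Bool} (hlen : x.length = x'.length)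
    (h : Fb s x = Fb s x') {k : ℕ} (hk : k ≤ 2 * s) : F s k x = F s k x' := by
  have h1 := flatMap_range_injOn (fun k => by simp only [length_Fbk, hlen]) h k (by omega)
  rw [Fbk, Fbk, ← hlen] at h1
  exact binary_injOn (F_lt_two_pow s k x) (hlen ▸ F_lt_two_pow s k x') h1

-- The difference of the accumulative sequences has at most `2 s` sign changes and, by the choice of
-- the moduli, vanishing moments up to order `2 s`.
open Finset in
theorem accum_eq_of_F_eq {s d e : ℕ} {x x' y : List Bool} (hlen : x.length = x'.length)
    (hy : y.length + 1 = x.length) (hde : d ≤ e) (he : e < x.length)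
    (hd : #(mismatches d x y) ≤ s) (hd' : #(mismatches e x' y) ≤ s)
    (hF : ∀ k ≤ 2 * s, F s k x = F s k x') :
    ∀ i < x.length, ∑ j ∈ range (i + 1), ((bitAt x j : ℤ) - bitAt x' j) = 0 := by
  have hbit (x : List Bool) (i : ℕ) : (bitAt x i : ℤ) = 0 ∨ (bitAt x i : ℤ) = 1 := by
    have := bitAt_le_one x i; omega
  have hq : #{j ∈ range (x.length - 1) |
      (bitAt x (skipIdx d j) : ℤ) ≠ bitAt x' (skipIdx e j)} ≤ 2 * s := by
    -- Where the two shortened words differ, at least one of them differs from `y`; this gives `s +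
    -- s` places.
    refine (card_le_card (t := mismatches d x y ∪ mismatches e x' y) fun j hj => ?_).trans
      ((card_union_le _ _).trans (by omega))
    simp only [mismatches, mem_union, mem_filter, mem_range] at hj ⊢
    have hj' : j < y.length := by omega
    simp only [hj', true_and]
    by_contra! h
    refine hj.2 ?_
    have h1 (d : ℕ) : skipIdx d j < x.length := by unfold skipIdx; split_ifs <;> omega
    exact_mod_cast (bitAt_eq_iff (h1 d) (hlen ▸ h1 e)).2 (h.1.symm.trans h.2)
  obtain ⟨habs, σ, hσ, hσu, hσc⟩ := accum_diff (hbit x) (hbit x') hde he hq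
  refine eq_zero_of_moments hσ hσu hσc fun k hk => ?_
  have hVT (x : List Bool) : ((VT k (accum x) : ℕ) : ℤ) = ∑ i ∈ range x.length,
      ((i : ℤ) + 1) ^ k * ∑ j ∈ range (i + 1), (bitAt x j : ℤ) := by
    rw [VT_accum]; push_cast; rfl
  have hdiff : ∑ i ∈ range x.length, ((i : ℤ) + 1) ^ k *
      ∑ j ∈ range (i + 1), ((bitAt x j : ℤ) - bitAt x' j) =
      ((VT k (accum x) : ℕ) : ℤ) - ((VT k (accum x') : ℕ) : ℤ) := by
    rw [hVT, hVT, ← hlen, ← sum_sub_distrib]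
    simp only [sum_sub_distrib, mul_sub]
  have hdvd : (modulus s k x.length : ℤ) ∣ ∑ i ∈ range x.length, ((i : ℤ) + 1) ^ k *
      ∑ j ∈ range (i + 1), ((bitAt x j : ℤ) - bitAt x' j) := by
    rw [hdiff]
    have h1 := hF k hk
    rw [F, F, ← hlen] at h1
    exact (Nat.modEq_iff_dvd (a := VT k (accum x')) (b := VT k (accum x))).1 h1.symm
  refine Int.eq_zero_of_abs_lt_dvd hdvd ?_
  have hmod : (modulus s k x.length : ℤ) =
      ∑ i ∈ range x.length, ((i : ℤ) + 1) ^ k * (((2 * s : ℕ) : ℤ) + 1) + 1 := by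
    have h2 : ∑ i ∈ Icc 1 x.length, i ^ k = ∑ i ∈ range x.length, (i + 1) ^ k := by
      rw [range_eq_Ico, sum_Ico_add' (fun i => i ^ k) 0 x.length 1]
      rfl
    rw [modulus, h2, ← sum_mul]; push_cast; ring
  -- The summand 1 in the modulus turns the termwise bound `|u i| ≤ 2 s + 1` into the strict
  -- inequality that is needed.
  rw [hmod, Int.lt_add_one_iff]
  refine (abs_sum_le_sum_abs _ _).trans (sum_le_sum fun i hi => ?_)
  rw [abs_mul, abs_of_nonneg (by positivity : (0 : ℤ) ≤ ((i : ℤ) + 1) ^ k)]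
  exact mul_le_mul_of_nonneg_left (habs i (mem_range.1 hi)) (by positivity)

open Finset in
/-- A word is determined by its length, its syndromes, and any word in its ball. -/
theorem Near.unique {s : ℕ} {x x' y : List Bool} (h : Near s x y) (h' : Near s x' y)
    (hFb : Fb s x = Fb s x') : x = x' := by
  obtain ⟨hy, d, hd, hm⟩ := h
  obtain ⟨hy', d', hd', hm'⟩ := h'
  have hlen : x.length = x'.length := by omega
  have hF : ∀ k ≤ 2 * s, F s k x = F s k x' := fun k hk => F_eq_of_Fb_eq hlen hFb hk
  have key : ∀ i < x.length, ∑ j ∈ range (i + 1), ((bitAt x j : ℤ) - bitAt x' j) = 0 := by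
    -- `accum_diff` needs the deletions in order; otherwise the two words exchange their roles and
    -- the difference is negated.
    rcases le_total d d' with hle | hle
    · exact accum_eq_of_F_eq hlen hy hle (by omega) hm hm' hF
    · intro i hi
      have := accum_eq_of_F_eq hlen.symm hy' hle (by omega) hm' hm (fun k hk => (hF k hk).symm) i
        (by omega)
      rw [← neg_eq_zero, ← sum_neg_distrib]
      simpa using this
  refine ext_bitAt hlen fun i hi => ?_
  cases i with
  | zero => simpa [sub_eq_zero] using key 0 hi
  | succ i =>
    have h1 := key (i + 1) hi
    rw [sum_range_succ, key i (by omega), zero_add, sub_eq_zero] at h1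
    exact_mod_cast h1

/-! ### The code -/

/-- The length of the codewords. -/
def codeLength (s n : ℕ) : ℕ :=
  n + syndromeLength s n + (2 * s + 2) * syndromeLength s (syndromeLength s n)

theorem length_encode (s : ℕ) (x : List Bool) : (encode s x).length = codeLength s x.length := by
  simp only [encode, List.length_append, length_repetition, length_Fb, codeLength]

/-- Every modulus is at least 2 for `n > 0`. So all parts of a codeword are nonempty, which is what
cutting the received word into windows requires. -/
theorem syndromeLength_pos (s : ℕ) {n : ℕ} (hn : 0 < n) : 0 < syndromeLength s n := by
  refine Finset.sum_pos (fun k _ => Nat.clog_pos (by norm_num) ?_) ⟨0, by simp⟩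
  have : 0 < ∑ i ∈ Finset.Icc 1 n, i ^ k :=
    Finset.sum_pos (fun i hi => pow_pos (Finset.mem_Icc.1 hi).1 k)
      ⟨1, Finset.mem_Icc.2 ⟨le_rfl, hn⟩⟩
  exact Nat.succ_lt_succ (Nat.mul_pos (by omega) this)

/-- The three parts of a received word are in the balls of the parts of the codeword. -/
theorem Near.parts {s : ℕ} {x y : List Bool} (hx : 0 < x.length) (h : Near s (encode s x) y) :
    Near s x (y.take (x.length - 1)) ∧
    Near s (Fb s x) ((y.drop x.length).take (syndromeLength s x.length - 1)) ∧
    Near s (repetition (2 * s + 2) (Fb s (Fb s x)))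
      (y.drop (x.length + syndromeLength s x.length)) := by
  have hm := syndromeLength_pos s hx
  have hm' := syndromeLength_pos s hm
  have h1 := h.append_left (by simp; omega)
  have h2 := h.append_right (by simp only [length_repetition, length_Fb]; positivity)
  rw [List.length_append, length_Fb] at h1 h2
  refine ⟨?_, ?_, h2⟩
  · have := h1.append_left hx
    rwa [List.take_take, min_eq_left (by omega)] at this
  · have := h1.append_right (by rwa [length_Fb])
    rw [List.drop_take] at this
    rwa [show x.length + syndromeLength s x.length - 1 - x.length =
      syndromeLength s x.length - 1 by omega] at this

theorem isCorrecting_code (s n : ℕ) : IsCorrecting 1 s (code s n) := by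
  rintro _ ⟨x, hx, rfl⟩ _ ⟨x', hx', rfl⟩ hne
  refine Set.disjoint_left.2 fun y hy hy' => hne ?_
  -- For `n = 0` there is only the empty message, and the windows would be meaningless.
  rcases Nat.eq_zero_or_pos n with rfl | hn
  · rw [List.length_eq_zero_iff.1 hx, List.length_eq_zero_iff.1 hx']
  obtain ⟨h1, h2, h3⟩ := (near_of_mem_ball hy).parts (by omega)
  obtain ⟨h1', h2', h3'⟩ := (near_of_mem_ball hy').parts (by omega)
  rw [hx] at h1 h2 h3
  rw [hx'] at h1' h2' h3'
  have h4 := h3.repetition_unique h3' (by simp only [length_Fb, hx, hx'])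
  rw [h1.unique h1' (h2.unique h2' h4)]

/-! ### The redundancy -/

theorem modulus_le (s k : ℕ) {n : ℕ} (hn : 0 < n) : modulus s k n ≤ (2 * s + 2) * n ^ (k + 1) := by
  have h1 : ∑ i ∈ Finset.Icc 1 n, i ^ k ≤ n ^ (k + 1) := by
    refine (Finset.sum_le_card_nsmul _ _ (n ^ k) fun i hi =>
      Nat.pow_le_pow_left (Finset.mem_Icc.1 hi).2 k).trans ?_
    simp [pow_succ, mul_comm]
  have h2 : 0 < n ^ (k + 1) := by positivity
  unfold modulus
  nlinarith

/-- The increments of `n ^ (k + 1)` are at most `(k + 1) (n + 1) ^ k`; summing them bounds the power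
by `k + 1` times the power sum. -/
theorem pow_le_modulus (s k n : ℕ) : n ^ (k + 1) ≤ (k + 1) * modulus s k n := by
  have h : n ^ (k + 1) ≤ (k + 1) * ∑ i ∈ Finset.Icc 1 n, i ^ k := by
    induction n with
    | zero => simp
    | succ n ih =>
      rw [Finset.sum_Icc_succ_top (by omega)]
      have h1 : (n + 1) ^ (k + 1) ≤ n ^ (k + 1) + (k + 1) * (n + 1) ^ k := by
        clear ih
        induction k with
        | zero => simp
        | succ k ih =>
          have h2 : n ^ (k + 1) ≤ (n + 1) ^ (k + 1) := Nat.pow_le_pow_left (by omega) _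
          calc (n + 1) ^ (k + 2) = n * (n + 1) ^ (k + 1) + (n + 1) ^ (k + 1) := by ring
            _ ≤ n * (n ^ (k + 1) + (k + 1) * (n + 1) ^ k) + (n + 1) ^ (k + 1) := by gcongr
            _ ≤ n ^ (k + 2) + (k + 1) * ((n + 1) * (n + 1) ^ k) + (n + 1) ^ (k + 1) := by
                have : n * (n + 1) ^ k ≤ (n + 1) * (n + 1) ^ k := by gcongr; omega
                have h3 : n * n ^ (k + 1) = n ^ (k + 2) := by ring
                nlinarith [Nat.mul_le_mul_left (k + 1) this]
            _ = _ := by ring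
      nlinarith
  refine h.trans (Nat.mul_le_mul_left _ ?_)
  exact (Nat.le_mul_of_pos_left _ (by omega)).trans (Nat.le_succ _)

/-- This crude linear bound, from `n ≤ 2 ^ n`, serves only the step counts: it keeps the loops over
the digits within `O(n)`. -/
theorem clog_modulus_le {s k n : ℕ} (hk : k ≤ 2 * s) (hn : 0 < n) :
    Nat.clog 2 (modulus s k n) ≤ (4 * s + 4) * n := by
  have h1 : modulus s k n ≤ 2 ^ (2 * s + 2 + n * (k + 1)) := by
    refine (modulus_le s k hn).trans ?_
    rw [pow_add 2, pow_mul]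
    exact Nat.mul_le_mul Nat.lt_two_pow_self.le (Nat.pow_le_pow_left Nat.lt_two_pow_self.le _)
  refine (Nat.clog_le_of_le_pow h1).trans ?_
  have : n * (k + 1) ≤ n * (2 * s + 1) := Nat.mul_le_mul_left _ (by omega)
  nlinarith

theorem syndromeLength_le (s : ℕ) {n : ℕ} (hn : 0 < n) :
    syndromeLength s n ≤ (2 * s + 1) * (4 * s + 4) * n := by
  refine (Finset.sum_le_card_nsmul _ _ ((4 * s + 4) * n) fun k hk =>
    clog_modulus_le (by simp at hk; omega) hn).trans ?_
  simp [mul_assoc]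

-- The modulus lies between `n ^ (k + 1) / (k + 1)` and `(2 s + 2) n ^ (k + 1)`. The additional 1
-- pays for rounding up the logarithm.
open Real in
theorem abs_clog_modulus_sub_le {s k n : ℕ} (hk : k ≤ 2 * s) (hn : 0 < n) :
    |(Nat.clog 2 (modulus s k n) : ℝ) - (k + 1) * logb 2 n| ≤ logb 2 (2 * s + 2) + 1 := by
  have hM : (1 : ℝ) ≤ modulus s k n := by simp [modulus]; positivity
  have hn' : (0 : ℝ) < n := by exact_mod_cast hn
  have h1 : logb 2 (modulus s k n) ≤ Nat.clog 2 (modulus s k n) := by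
    rw [← Real.natCeil_logb_natCast]; exact Nat.le_ceil _
  have h2 : (Nat.clog 2 (modulus s k n) : ℝ) < logb 2 (modulus s k n) + 1 := by
    rw [← Real.natCeil_logb_natCast]
    exact Nat.ceil_lt_add_one (logb_nonneg (by norm_num) hM)
  have h3 : logb 2 (modulus s k n) ≤ logb 2 (2 * s + 2) + (k + 1) * logb 2 n := by
    have : (modulus s k n : ℝ) ≤ (2 * s + 2) * (n : ℝ) ^ (k + 1) := by
      exact_mod_cast modulus_le s k hn
    calc _ ≤ _ := logb_le_logb_of_le (by norm_num) (by linarith) this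
      _ = _ := by rw [logb_mul (by positivity) (by positivity), logb_pow]; push_cast; ring
  have h4 : (k + 1) * logb 2 n ≤ logb 2 (2 * s + 2) + logb 2 (modulus s k n) := by
    have h5 : (n : ℝ) ^ (k + 1) ≤ (2 * s + 2) * modulus s k n := by
      have h6 : ((k : ℝ) + 1) ≤ 2 * s + 2 := by
        have : (k : ℝ) ≤ 2 * s := by exact_mod_cast hk
        linarith
      have h7 : (n : ℝ) ^ (k + 1) ≤ (k + 1) * modulus s k n := by
        exact_mod_cast pow_le_modulus s k n
      nlinarith
    calc (k + 1) * logb 2 n = logb 2 ((n : ℝ) ^ (k + 1)) := by rw [logb_pow]; push_cast; ring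
      _ ≤ _ := logb_le_logb_of_le (by norm_num) (by positivity) h5
      _ = _ := by rw [logb_mul (by positivity) (by positivity)]
  rw [abs_le]
  constructor <;> linarith

-- The coefficient is `1 + 2 + ⋯ + (2 s + 1)`, one summand for each order of syndrome.
open Real in
theorem abs_syndromeLength_sub_le (s : ℕ) {n : ℕ} (hn : 0 < n) :
    |(syndromeLength s n : ℝ) - (s + 1) * (2 * s + 1) * logb 2 n| ≤
      (2 * s + 1) * (logb 2 (2 * s + 2) + 1) := by
  have hsum : ((s : ℝ) + 1) * (2 * s + 1) = ∑ k ∈ Finset.range (2 * s + 1), ((k : ℝ) + 1) := by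
    rw [Finset.sum_add_distrib]
    have h := Finset.sum_range_id_mul_two (2 * s + 1)
    have h' : ((∑ k ∈ Finset.range (2 * s + 1), k : ℕ) : ℝ) * 2 = (2 * s + 1) * (2 * s) := by
      exact_mod_cast h
    push_cast at h'
    simp only [Finset.sum_const, Finset.card_range, nsmul_eq_mul, mul_one]
    push_cast
    linarith
  rw [hsum, Finset.sum_mul, syndromeLength, Nat.cast_sum, ← Finset.sum_sub_distrib]
  refine (Finset.abs_sum_le_sum_abs _ _).trans ((Finset.sum_le_card_nsmul _ _ _ fun k hk =>
    abs_clog_modulus_sub_le (by simp at hk; omega) hn).trans ?_)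
  simp [mul_add]

theorem encode_injOn (s : ℕ) {x x' : List Bool} (hlen : x.length = x'.length)
    (h : encode s x = encode s x') : x = x' := by
  simp only [encode, List.append_assoc] at h
  exact (List.append_inj h hlen).1

/-- The encoder is systematic: the message is a prefix of its codeword, so encoding is injective. -/
theorem ncard_code (s n : ℕ) : (code s n).ncard = 2 ^ n := by
  have h : code s n = Set.range fun x : List.Vector Bool n => encode s x.1 := by
    ext c
    constructor
    · rintro ⟨x, hx, rfl⟩
      exact ⟨⟨x, hx⟩, rfl⟩
    · rintro ⟨x, rfl⟩
      exact ⟨x.1, x.2, rfl⟩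
  rw [h, Set.ncard_range_of_injective, Nat.card_eq_fintype_card, card_vector, Fintype.card_bool]
  intro x x' h
  exact Subtype.ext (encode_injOn s (by rw [x.2, x'.2]) h)

theorem redundancy_code (s n : ℕ) : redundancy 2 (codeLength s n) (code s n) =
    syndromeLength s n + (2 * s + 2) * syndromeLength s (syndromeLength s n) := by
  rw [redundancy, ncard_code, codeLength]
  push_cast
  rw [Real.logb_pow, Real.logb_self_eq_one (by norm_num)]
  ring

open Real in
theorem redundancy_isBigO (s : ℕ) :
    (fun n : ℕ => redundancy 2 (codeLength s n) (code s n) -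
      ((s : ℝ) + 1) * (2 * (s : ℝ) + 1) * logb 2 (n : ℝ))
        =O[Filter.atTop] (fun n : ℕ => logb 2 (logb 2 (n : ℝ))) := by
  set A : ℝ := ((s : ℝ) + 1) * (2 * s + 1) with hA
  set C : ℝ := (2 * s + 1) * (logb 2 (2 * s + 2) + 1) with hC
  have hA0 : 0 < A := by positivity
  have hC0 : 0 ≤ C := by
    have : 0 ≤ logb 2 (2 * (s : ℝ) + 2) := 
      logb_nonneg (by norm_num) (by linarith [s.cast_nonneg (α := ℝ)])
    positivity
  have hAC : 1 ≤ A + C := by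
    have : (0 : ℝ) ≤ s := s.cast_nonneg
    nlinarith
  refine Asymptotics.IsBigO.of_bound (C + (2 * s + 2) * (A * (logb 2 (A + C) + 1) + C)) ?_
  -- From `n = 4` on, `log log n ≥ 1`, so additive constants are absorbed. The first syndromes have
  -- at most `(A + C) log n` bits; applying the bound again to that length gives the double
  -- logarithm.
  filter_upwards [Filter.eventually_ge_atTop 4] with n hn
  have hn' : (4 : ℝ) ≤ n := by exact_mod_cast hn
  have hl2 : (2 : ℝ) ≤ logb 2 n := by
    rw [le_logb_iff_rpow_le (by norm_num) (by linarith)]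
    norm_num
    exact hn
  have hll : (1 : ℝ) ≤ logb 2 (logb 2 n) := by
    rw [le_logb_iff_rpow_le (by norm_num) (by linarith)]
    simpa using hl2
  have hm := syndromeLength_pos s (show 0 < n by omega)
  have h1 := abs_le.1 (abs_syndromeLength_sub_le s (show 0 < n by omega))
  have h2 := abs_le.1 (abs_syndromeLength_sub_le s hm)
  rw [← hA, ← hC] at h1 h2
  have hm' : (0 : ℝ) < syndromeLength s n := by exact_mod_cast hm
  have h3 : logb 2 (syndromeLength s n) ≤ logb 2 (A + C) + logb 2 (logb 2 n) := by
    rw [← logb_mul (by linarith) (by linarith)]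
    refine logb_le_logb_of_le (by norm_num) hm' ?_
    nlinarith
  have h4 : 0 ≤ logb 2 (A + C) := logb_nonneg (by norm_num) hAC
  have h5 : (syndromeLength s (syndromeLength s n) : ℝ) ≤
      (A * (logb 2 (A + C) + 1) + C) * logb 2 (logb 2 n) := by
    have h6 : A * logb 2 (syndromeLength s n) ≤ A * ((logb 2 (A + C) + 1) * logb 2 (logb 2 n)) := by
      refine mul_le_mul_of_nonneg_left (h3.trans ?_) hA0.le
      nlinarith
    nlinarith
  have h7 : (0 : ℝ) ≤ syndromeLength s (syndromeLength s n) := Nat.cast_nonneg _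
  rw [redundancy_code, norm_eq_abs, norm_of_nonneg (by linarith : 0 ≤ logb 2 (logb 2 n)), abs_le]
  have hs : (0 : ℝ) ≤ 2 * s + 2 := by positivity
  have h8 := mul_le_mul_of_nonneg_left h5 hs
  have h9 : 0 ≤ (2 * (s : ℝ) + 2) * syndromeLength s (syndromeLength s n) := mul_nonneg hs h7
  have h10 : C ≤ C * logb 2 (logb 2 n) := le_mul_of_one_le_right hC0 hll
  constructor <;> nlinarith

end DelSub

namespace WordRAM

open DelSub

/-! ### Programs with expressions

The registers `R[0], …, R[63]` are variables; the other registers hold intermediate results. -/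

/-- Assign `x` to the register `R[v]`. -/
def State.set (a : State) (v x : ℕ) : State := { a with reg := Function.update a.reg v x }

/-- Assign `x` to the memory cell `M[p]`. -/
def State.write (a : State) (p x : ℕ) : State := { a with mem := Function.update a.mem p x }

@[simp] theorem State.reg_set (a : State) (v x r : ℕ) :
    (a.set v x).reg r = if r = v then x else a.reg r := by
  simp [State.set, Function.update_apply]

@[simp] theorem State.mem_set (a : State) (v x : ℕ) : (a.set v x).mem = a.mem := rfl

@[simp] theorem State.reg_write (a : State) (p x : ℕ) : (a.write p x).reg = a.reg := rfl

@[simp] theorem State.mem_write (a : State) (p x i : ℕ) :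
    (a.write p x).mem i = if i = p then x else a.mem i := by
  simp [State.write, Function.update_apply]

/-- Arithmetic expressions in the variables and the memory. -/
inductive Expr
  | var (r : ℕ)
  | lit (v : ℕ)
  | bin (o : BinOp) (e f : Expr)
  | mem (e : Expr)

namespace Expr

instance : Add Expr := ⟨.bin .add⟩
instance : Sub Expr := ⟨.bin .sub⟩
instance : Mul Expr := ⟨.bin .mul⟩
instance : Div Expr := ⟨.bin .div⟩
instance : Mod Expr := ⟨.bin .mod⟩

def eval (a : State) : Expr → ℕ
  | var r => a.reg r
  | lit v => v
  | bin o e f => o.eval (e.eval a) (f.eval a)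
  | mem e => a.mem (e.eval a)

/-- The number of steps in which an expression is evaluated. -/
def cost : Expr → ℕ
  | var _ => 2
  | lit _ => 1
  | bin _ e f => e.cost + f.cost + 1
  | mem e => e.cost + 1

/-- All intermediate results in the evaluation of an expression are below `B`. -/
def Ok (B : ℕ) (a : State) : Expr → Prop
  | var r => r < 64 ∧ a.reg r < B
  | lit v => v < B
  | bin o e f => (e.Ok B a ∧ f.Ok B a) ∧ o.eval (e.eval a) (f.eval a) < B
  | mem e => e.Ok B a ∧ a.mem (e.eval a) < B

/-- Evaluate an expression into the register `R[d]` with the help of the registers after it. -/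
def compile : Expr → ℕ → Program
  | var r, d => .seq (.instr (.const d 0)) (.instr (.arith .add d r d))
  | lit v, d => .instr (.const d v)
  | bin o e f, d => .seq (.seq (e.compile d) (f.compile (d + 1))) (.instr (.arith o d d (d + 1)))
  | mem e, d => .seq (e.compile d) (.instr (.load d d))

variable (B : ℕ) (a : State) (e f : Expr)

@[simp] theorem eval_var (r : ℕ) : (var r).eval a = a.reg r := rfl
@[simp] theorem eval_lit (v : ℕ) : (lit v).eval a = v := rfl
@[simp] theorem eval_mem : (mem e).eval a = a.mem (e.eval a) := rfl
@[simp] theorem eval_add : (e + f).eval a = e.eval a + f.eval a := rfl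
@[simp] theorem eval_sub : (e - f).eval a = e.eval a - f.eval a := rfl
@[simp] theorem eval_mul : (e * f).eval a = e.eval a * f.eval a := rfl
@[simp] theorem eval_div : (e / f).eval a = e.eval a / f.eval a := rfl
@[simp] theorem eval_mod : (e % f).eval a = e.eval a % f.eval a := rfl

@[simp] theorem cost_var (r : ℕ) : (var r).cost = 2 := rfl
@[simp] theorem cost_lit (v : ℕ) : (lit v).cost = 1 := rfl
@[simp] theorem cost_mem : (mem e).cost = e.cost + 1 := rfl
@[simp] theorem cost_add : (e + f).cost = e.cost + f.cost + 1 := rfl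
@[simp] theorem cost_sub : (e - f).cost = e.cost + f.cost + 1 := rfl
@[simp] theorem cost_mul : (e * f).cost = e.cost + f.cost + 1 := rfl
@[simp] theorem cost_div : (e / f).cost = e.cost + f.cost + 1 := rfl
@[simp] theorem cost_mod : (e % f).cost = e.cost + f.cost + 1 := rfl

@[simp] theorem ok_var (r : ℕ) : (var r).Ok B a ↔ r < 64 ∧ a.reg r < B := Iff.rfl
@[simp] theorem ok_lit (v : ℕ) : (lit v).Ok B a ↔ v < B := Iff.rfl
@[simp] theorem ok_mem : (mem e).Ok B a ↔ e.Ok B a ∧ a.mem (e.eval a) < B := Iff.rfl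
@[simp] theorem ok_add :
    (e + f).Ok B a ↔ (e.Ok B a ∧ f.Ok B a) ∧ e.eval a + f.eval a < B := Iff.rfl
@[simp] theorem ok_mul :
    (e * f).Ok B a ↔ (e.Ok B a ∧ f.Ok B a) ∧ e.eval a * f.eval a < B := Iff.rfl

variable {B a e f}

theorem Ok.eval_lt (h : e.Ok B a) : e.eval a < B := by
  cases e with
  | var r => exact h.2
  | lit v => exact h
  | bin o e f => exact h.2
  | mem e => exact h.2

@[simp] theorem ok_sub : (e - f).Ok B a ↔ e.Ok B a ∧ f.Ok B a :=
  ⟨fun h => h.1, fun h => ⟨h, (Nat.sub_le _ _).trans_lt h.1.eval_lt⟩⟩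

@[simp] theorem ok_div : (e / f).Ok B a ↔ e.Ok B a ∧ f.Ok B a :=
  ⟨fun h => h.1, fun h => ⟨h, (Nat.div_le_self _ _).trans_lt h.1.eval_lt⟩⟩

@[simp] theorem ok_mod : (e % f).Ok B a ↔ e.Ok B a ∧ f.Ok B a :=
  ⟨fun h => h.1, fun h => ⟨h, (Nat.mod_le _ _).trans_lt h.1.eval_lt⟩⟩

/-- The power of an expression with a fixed exponent. -/
def pow (e : Expr) : ℕ → Expr
  | 0 => .lit 1
  | k + 1 => pow e k * e

@[simp] theorem eval_pow (k : ℕ) : (e.pow k).eval a = e.eval a ^ k := by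
  induction k with
  | zero => rfl
  | succ k ih => simp [pow, ih, pow_succ]

@[simp] theorem cost_pow (k : ℕ) : (e.pow k).cost = k * (e.cost + 1) + 1 := by
  induction k with
  | zero => simp [pow]
  | succ k ih => simp [pow, ih]; ring

theorem Ok.pow {b k : ℕ} (h : e.Ok B a) (hb : e.eval a ≤ b) (hb1 : 1 ≤ b) (hk : b ^ k < B) :
    (e.pow k).Ok B a := by
  induction k with
  | zero => simpa [Expr.pow] using hk
  | succ k ih =>
    refine (ok_mul _ _ _ _).2
      ⟨⟨ih ((Nat.pow_le_pow_right hb1 (Nat.le_succ k)).trans_lt hk), h⟩, ?_⟩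
    rw [eval_pow, ← pow_succ]
    exact (Nat.pow_le_pow_left hb _).trans_lt hk

end Expr

/-! ### Correctness and cost of compiled expressions -/

/-- The configurations agree in the variables and the memory. -/
def Agree (σ a : State) : Prop := (∀ r < 64, σ.reg r = a.reg r) ∧ σ.mem = a.mem

/-- The registers from `d` on act as a stack: evaluation leaves everything below `d` alone, so the
first operand survives the evaluation of the second, and the variables survive everything. -/
theorem Expr.exec_compile {w B : ℕ} (hB : B ≤ 2 ^ w) {a : State} (e : Expr) (he : e.Ok B a)
    (d : ℕ) (hd : 64 ≤ d) (σ : State) (h : Agree σ a) :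
    ∃ τ, Exec w (e.compile d) σ e.cost τ ∧ τ.mem = σ.mem ∧ (∀ r < d, τ.reg r = σ.reg r) ∧
      τ.reg d = e.eval a := by
  induction e generalizing d σ with
  | var r =>
    obtain ⟨hr, hv⟩ := he
    refine ⟨_, .seq (.instr (.const d 0) σ (by simp [Instr.value])) (.instr _ _ ?_), ?_, ?_, ?_⟩
    · simpa [Instr.value, Instr.apply, BinOp.eval, Function.update_apply,
        show r ≠ d by omega, h.1 r hr] using hv.trans_le hB
    · simp [Instr.apply]
    · intro i hi
      simp [Instr.apply, show i ≠ d by omega]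
    · simp [Instr.value, Instr.apply, BinOp.eval, show r ≠ d by omega, h.1 r hr, Expr.eval]
  | lit v =>
    refine ⟨_, .instr (.const d v) σ (he.trans_le hB), rfl, ?_, ?_⟩
    · intro i hi
      simp [Instr.apply, show i ≠ d by omega]
    · simp [Instr.value, Instr.apply, Expr.eval]
  | bin o e f ihe ihf =>
    obtain ⟨⟨he1, hf1⟩, hv⟩ := he
    obtain ⟨τ, h1, h2, h3, h4⟩ := ihe he1 d hd σ h
    obtain ⟨υ, h5, h6, h7, h8⟩ := ihf hf1 (d + 1) (by omega) τ
      ⟨fun r hr => (h3 r (by omega)).trans (h.1 r hr), h2.trans h.2⟩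
    have h9 : υ.reg d = e.eval a := (h7 d (by omega)).trans h4
    refine ⟨_, .seq (.seq h1 h5) (.instr (.arith o d d (d + 1)) υ ?_), ?_, ?_, ?_⟩
    · simpa [Instr.value, h9, h8] using hv.trans_le hB
    · simp [Instr.apply, h6, h2]
    · intro i hi
      simp [Instr.apply, show i ≠ d by omega, h7 i (by omega), h3 i hi]
    · simp [Instr.value, Instr.apply, h9, h8, Expr.eval]
  | mem e ihe =>
    obtain ⟨he1, hv⟩ := he
    obtain ⟨τ, h1, h2, h3, h4⟩ := ihe he1 d hd σ h
    refine ⟨_, .seq h1 (.instr (.load d d) τ ?_), ?_, ?_, ?_⟩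
    · simpa [Instr.value, h4, h2, h.2] using hv.trans_le hB
    · simp [Instr.apply, h2]
    · intro i hi
      simp [Instr.apply, show i ≠ d by omega, h3 i hi]
    · simp [Instr.value, Instr.apply, h4, h2, h.2, Expr.eval]

/-! ### Assignments, stores and loops with timed Hoare rules -/

/-- Assign the value of `e` to the variable `R[v]`. -/
def assign (v : ℕ) (e : Expr) : Program :=
  .seq (e.compile 64) (.seq (.instr (.const v 0)) (.instr (.arith .add v 64 v)))

/-- Store the value of `f` at the address `e`. -/
def storeAt (e f : Expr) : Program :=
  .seq (.seq (e.compile 64) (f.compile 65)) (.instr (.store 64 65))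

/-- Run `p` for all values of the variable `R[v]` below `R[l]`. -/
def forLoop (v l : ℕ) (p : Program) : Program :=
  .seq (assign v (.lit 0)) (.whileLt v l (.seq p (assign v (.var v + .lit 1))))

/-- Started in `a`, up to the registers that are not variables, the program halts after at most `T`
steps in a configuration with the property `Q`. -/
def Runs (B : ℕ) (p : Program) (a : State) (T : ℕ) (Q : State → Prop) : Prop :=
  ∀ w, B ≤ 2 ^ w → ∀ σ, Agree σ a → ∃ t ≤ T, ∃ τ b, Exec w p σ t τ ∧ Agree τ b ∧ Q b

namespace Runs

variable {B T U : ℕ} {p q : Program} {a : State} {Q R : State → Prop}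

theorem mono (h : Runs B p a T Q) (hT : T ≤ U) (hQ : ∀ b, Q b → R b) : Runs B p a U R := by
  intro w hw σ hσ
  obtain ⟨t, ht, τ, b, h1, h2, h3⟩ := h w hw σ hσ
  exact ⟨t, ht.trans hT, τ, b, h1, h2, hQ b h3⟩

theorem mono_time (h : Runs B p a T Q) (hT : T ≤ U) : Runs B p a U Q := h.mono hT fun _ => id

theorem seq (h : Runs B p a T fun b => Runs B q b U Q) : Runs B (.seq p q) a (T + U) Q := by
  intro w hw σ hσ
  obtain ⟨t, ht, τ, b, h1, h2, h3⟩ := h w hw σ hσ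
  obtain ⟨u, hu, υ, c, h4, h5, h6⟩ := h3 w hw τ h2
  exact ⟨t + u, by omega, υ, c, .seq h1 h4, h5, h6⟩

theorem assign {v : ℕ} {e : Expr} (hv : v < 64) (he : e.Ok B a) (hQ : Q (a.set v (e.eval a))) :
    Runs B (assign v e) a (e.cost + 2) Q := by
  intro w hw σ hσ
  obtain ⟨τ, h1, h2, h3, h4⟩ := e.exec_compile hw he 64 le_rfl σ hσ
  refine ⟨_, le_rfl, _, a.set v (e.eval a), .seq h1 (.seq (.instr (.const v 0) τ
    (by simp [Instr.value])) (.instr (.arith .add v 64 v) _ ?_)), ⟨?_, ?_⟩, hQ⟩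
  · simpa [Instr.value, Instr.apply, BinOp.eval, Function.update_apply, show 64 ≠ v by omega, h4]
      using he.eval_lt.trans_le hw
  · intro r hr
    simp only [Instr.value, Instr.apply, BinOp.eval, Function.update_apply, State.reg_set]
    split_ifs
    · omega
    · simpa using h4
    · rw [h3 r hr, hσ.1 r hr]
  · simp [Instr.apply, h2, hσ.2]

theorem storeAt {e f : Expr} (he : e.Ok B a) (hf : f.Ok B a)
    (hQ : Q (a.write (e.eval a) (f.eval a))) :
    Runs B (storeAt e f) a (e.cost + f.cost + 1) Q := by
  intro w hw σ hσ
  obtain ⟨τ, h1, h2, h3, h4⟩ := e.exec_compile hw he 64 le_rfl σ hσ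
  obtain ⟨υ, h5, h6, h7, h8⟩ := f.exec_compile hw hf 65 (by norm_num) τ
    ⟨fun r hr => (h3 r hr).trans (hσ.1 r hr), h2.trans hσ.2⟩
  refine ⟨_, le_rfl, _, _, .seq (.seq h1 h5) (.instr (.store 64 65) υ ?_), ⟨?_, ?_⟩, hQ⟩
  · simpa [Instr.value, h8] using hf.eval_lt.trans_le hw
  · intro r hr
    simp [Instr.apply, h7 r (by omega), h3 r hr, hσ.1 r hr]
  · simp [Instr.apply, Instr.value, State.write, h8, h7 64 (by norm_num), h4, h6, h2, hσ.2]

theorem ifLt {x y : ℕ} (hx : x < 64) (hy : y < 64) (hp : a.reg x < a.reg y → Runs B p a T Q)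
    (hq : ¬ a.reg x < a.reg y → Runs B q a T Q) : Runs B (.ifLt x y p q) a (T + 1) Q := by
  intro w hw σ hσ
  by_cases h : a.reg x < a.reg y
  · obtain ⟨t, ht, τ, b, h1, h2⟩ := hp h w hw σ hσ
    exact ⟨t + 1, by omega, τ, b, .ifTrue (by rwa [hσ.1 x hx, hσ.1 y hy]) h1, h2⟩
  · obtain ⟨t, ht, τ, b, h1, h2⟩ := hq h w hw σ hσ
    exact ⟨t + 1, by omega, τ, b, .ifFalse (by rwa [hσ.1 x hx, hσ.1 y hy]) h1, h2⟩

theorem skip (hQ : Q a) : Runs B .skip a 1 Q :=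
  fun _ _ σ hσ => ⟨1, le_rfl, σ, a, .skip σ, hσ, hQ⟩

/-- The number of rounds is prescribed by the indexed invariant, so termination and the time bound
come from an induction on the rounds that are left. -/
theorem whileLt {x y N : ℕ} {I : ℕ → State → Prop} (hx : x < 64) (hy : y < 64)
    (hstep : ∀ i < N, ∀ b, I i b → b.reg x < b.reg y ∧ Runs B p b T (I (i + 1)))
    (hend : ∀ b, I N b → ¬ b.reg x < b.reg y) (h0 : I 0 a) :
    Runs B (.whileLt x y p) a (N * (T + 1) + 1) (I N) := by
  suffices H : ∀ j i b, i + j = N → I i b → Runs B (.whileLt x y p) b (j * (T + 1) + 1) (I N) from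
    H N 0 a (zero_add N) h0
  intro j
  induction j with
  | zero =>
    intro i b hi hb w hw σ hσ
    obtain rfl : i = N := by omega
    exact ⟨1, by omega, σ, b,
      .whileFalse (by rw [hσ.1 x hx, hσ.1 y hy]; exact hend b hb), hσ, hb⟩
  | succ j ih =>
    intro i b hi hb w hw σ hσ
    obtain ⟨h1, h2⟩ := hstep i (by omega) b hb
    obtain ⟨t, ht, τ, c, h3, h4, h5⟩ := h2 w hw σ hσ
    obtain ⟨u, hu, υ, d, h6, h7, h8⟩ := ih (i + 1) c (by omega) h5 w hw τ h4
    refine ⟨t + u + 1, ?_, υ, d, .whileTrue (by rwa [hσ.1 x hx, hσ.1 y hy]) h3 h6, h7, h8⟩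
    rw [add_mul]; omega

/-- The body must establish the invariant for the state in which the counter has already been
advanced. Besides the body, a round costs 6 steps for the increment and 1 for the test; 3 steps
initialise the counter and 1 is the last test. -/
theorem forLoop {v l N : ℕ} {I : ℕ → State → Prop} (hv : v < 64) (hl : l < 64) (hN : N < B)
    (hlim : ∀ i b, I i b → b.reg l = N)
    (hstep : ∀ i < N, ∀ b, I i b → b.reg v = i →
      Runs B p b T fun c => c.reg v = i ∧ I (i + 1) (c.set v (i + 1)))
    (h0 : I 0 (a.set v 0)) :
    Runs B (forLoop v l p) a (N * (T + 7) + 4) fun b => I N b ∧ b.reg v = N := by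
  refine mono_time (seq (T := 3) (U := N * (T + 7) + 1) (assign hv (show 0 < B by omega) ?_))
    (by omega)
  refine whileLt (T := T + 6) (I := fun i b => I i b ∧ b.reg v = i) hv hl ?_ ?_ ⟨h0, by simp⟩
  · rintro i hi b ⟨hb, hbv⟩
    refine ⟨by rw [hbv, hlim i b hb]; exact hi, seq ((hstep i hi b hb hbv).mono le_rfl ?_)⟩
    rintro c ⟨hc, hI⟩
    refine assign hv ⟨⟨⟨hv, ?_⟩, ?_⟩, ?_⟩ (by simpa [hc] using hI)
    · omega
    · show 1 < B
      omega
    · show c.reg v + 1 < B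
      omega
  · rintro b ⟨hb, hbv⟩
    rw [hbv, hlim N b hb]
    exact lt_irrefl N

theorem assign_seq {v : ℕ} {e : Expr} (hv : v < 64) (he : e.Ok B a)
    (h : Runs B q (a.set v (e.eval a)) T Q) :
    Runs B (.seq (WordRAM.assign v e) q) a (e.cost + 2 + T) Q := seq (assign hv he h)

theorem storeAt_seq {e f : Expr} (he : e.Ok B a) (hf : f.Ok B a)
    (h : Runs B q (a.write (e.eval a) (f.eval a)) T Q) :
    Runs B (.seq (WordRAM.storeAt e f) q) a (e.cost + f.cost + 1 + T) Q := seq (storeAt he hf h)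

end Runs

/-! ### Unchanged variables and words in memory -/

/-- The variables `R[0], …, R[m - 1]` have the same values. -/
def SameRegs (m : ℕ) (a b : State) : Prop := ∀ r < m, b.reg r = a.reg r

namespace SameRegs

variable {m : ℕ} {a b c : State}

theorem refl : SameRegs m a a := fun _ _ => rfl

theorem trans (h : SameRegs m a b) (h' : SameRegs m b c) : SameRegs m a c :=
  fun r hr => (h' r hr).trans (h r hr)

theorem mono {k : ℕ} (h : SameRegs m a b) (hk : k ≤ m) : SameRegs k a b :=
  fun r hr => h r (hr.trans_le hk)

theorem set {v x : ℕ} (h : SameRegs m a b) (hv : m ≤ v) : SameRegs m a (b.set v x) := by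
  intro r hr
  rw [State.reg_set, if_neg (by omega), h r hr]

theorem write {p x : ℕ} (h : SameRegs m a b) : SameRegs m a (b.write p x) := h

end SameRegs

/-- The word `x` is in the memory, from the address `p` on. -/
def Holds (mem : ℕ → ℕ) (p : ℕ) (x : List Bool) : Prop := ∀ i < x.length, mem (p + i) = bitAt x i

theorem bitAt_append_left {u v : List Bool} {i : ℕ} (h : i < u.length) :
    bitAt (u ++ v) i = bitAt u i := by
  simp [bitAt, List.getD_eq_getElem?_getD, List.getElem?_append_left h]

theorem bitAt_append_right (u v : List Bool) (i : ℕ) :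
    bitAt (u ++ v) (u.length + i) = bitAt v i := by
  simp [bitAt, List.getD_eq_getElem?_getD, List.getElem?_append_right]

theorem Holds.append {mem : ℕ → ℕ} {p : ℕ} {u v : List Bool} (hu : Holds mem p u)
    (hv : Holds mem (p + u.length) v) : Holds mem p (u ++ v) := by
  intro i hi
  rw [List.length_append] at hi
  by_cases h : i < u.length
  · rw [bitAt_append_left h, hu i h]
  · obtain ⟨j, rfl⟩ := Nat.exists_eq_add_of_le (not_lt.1 h)
    rw [bitAt_append_right, ← hv j (by omega), add_assoc]

theorem Holds.congr {mem mem' : ℕ → ℕ} {p : ℕ} {u : List Bool} (hu : Holds mem p u)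
    (h : ∀ i < u.length, mem' (p + i) = mem (p + i)) : Holds mem' p u :=
  fun i hi => (h i hi).trans (hu i hi)

/-! ### Computing the syndromes

The address and the length of a word are in `R[40]` and `R[41]`. Its syndromes are written from the
address in `R[42]` on, and their length is put into `R[43]`. -/

/-- Compute `VT k (accum x)` in `R[46]` and `∑ i = 1, …, |x|, iᵏ` in `R[47]`. -/
def vtProgram (k : ℕ) : Program :=
  .seq (assign 45 (.lit 0)) <| .seq (assign 46 (.lit 0)) <| .seq (assign 47 (.lit 0)) <|
    forLoop 44 41 <|
      .seq (assign 45 (.var 45 + .mem (.var 40 + .var 44))) <|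
      .seq (assign 46 (.var 46 + (Expr.var 44 + .lit 1).pow k * .var 45)) <|
      assign 47 (.var 47 + (Expr.var 44 + .lit 1).pow k)

-- The prefix sum is carried along, so a round has constant cost. With `U` above all addresses and
-- lengths, the prefix sums are at most `U`, the terms at most `U ^ (k + 1)` and the syndrome at
-- most `U ^ (k + 2)`; one more power leaves room for strict bounds.
open Finset in
theorem runs_vtProgram {B U k src : ℕ} {x : List Bool} {a : State} (hx : Holds a.mem src x)
    (h40 : a.reg 40 = src) (h41 : a.reg 41 = x.length) (hU : src + x.length + 2 ≤ U)
    (hB : U ^ (k + 3) ≤ B) :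
    Runs B (vtProgram k) a (x.length * (10 * k + 41) + 13) fun b =>
      SameRegs 44 a b ∧ b.mem = a.mem ∧ b.reg 46 = VT k (accum x) ∧ b.reg 46 < B ∧
        b.reg 47 = ∑ i ∈ range x.length, (i + 1) ^ k := by
  have hU0 : 0 < U := by omega
  have hpow1 : U ≤ U ^ (k + 1) := Nat.le_self_pow (by omega) U
  have hpow0 : U ^ k ≤ U ^ (k + 1) := Nat.pow_le_pow_right hU0 (by omega)
  have hpow2 : U ^ (k + 1) * 2 ≤ U ^ (k + 2) := by
    rw [pow_succ U (k + 1)]; exact Nat.mul_le_mul_left _ (by omega)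
  have hpow3 : U ^ (k + 2) * 2 ≤ U ^ (k + 3) := by
    rw [pow_succ U (k + 2)]; exact Nat.mul_le_mul_left _ (by omega)
  have hacc (i : ℕ) : ∑ j ∈ range i, bitAt x j ≤ i := by
    simpa using sum_le_card_nsmul (range i) _ 1 fun j _ => bitAt_le_one x j
  have hterm (i : ℕ) (hi : i < x.length) :
      (i + 1) ^ k * ∑ j ∈ range (i + 1), bitAt x j ≤ U ^ (k + 1) := by
    rw [pow_succ]
    exact Nat.mul_le_mul (Nat.pow_le_pow_left (by omega) k) ((hacc _).trans (by omega))
  have hsum (i : ℕ) (hi : i ≤ x.length) :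
      ∑ m ∈ range i, (m + 1) ^ k * ∑ j ∈ range (m + 1), bitAt x j ≤ U ^ (k + 2) := by
    refine (sum_le_card_nsmul _ _ (U ^ (k + 1)) fun m hm =>
      hterm m (by rw [mem_range] at hm; omega)).trans ?_
    rw [card_range, smul_eq_mul, pow_succ U (k + 1), mul_comm]
    exact Nat.mul_le_mul_left _ (by omega)
  have hpsum (i : ℕ) (hi : i ≤ x.length) : ∑ m ∈ range i, (m + 1) ^ k ≤ U ^ (k + 1) := by
    refine (sum_le_card_nsmul _ _ (U ^ k) fun m hm =>
      Nat.pow_le_pow_left (by rw [mem_range] at hm; omega) k).trans ?_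
    rw [card_range, smul_eq_mul, pow_succ, mul_comm]
    exact Nat.mul_le_mul_left _ (by omega)
  refine Runs.mono_time (T := _) (Runs.assign_seq (by norm_num) (show 0 < B by omega) <|
    Runs.assign_seq (by norm_num) (show 0 < B by omega) <|
    Runs.assign_seq (by norm_num) (show 0 < B by omega) <|
    (Runs.forLoop (T := 10 * k + 34) (N := x.length)
      (I := fun i b => SameRegs 44 a b ∧ b.mem = a.mem ∧ b.reg 45 = ∑ j ∈ range i, bitAt x j ∧
        b.reg 46 = ∑ m ∈ range i, (m + 1) ^ k * ∑ j ∈ range (m + 1), bitAt x j ∧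
        b.reg 47 = ∑ m ∈ range i, (m + 1) ^ k)
      (by norm_num) (by norm_num) (by omega) ?_ ?_ ?_).mono le_rfl ?_) ?_
  · rintro i b ⟨hb, -⟩
    rw [hb 41 (by norm_num), h41]
  · rintro i hi b ⟨hb, hmem, h45, h46, h47⟩ h44
    have hb40 : b.reg 40 = src := (hb 40 (by norm_num)).trans h40
    have hbit := bitAt_le_one x i
    have h1 := hacc i
    have h2 := hterm i hi
    have h3 := hsum i hi.le
    have h3' := hsum (i + 1) hi
    have h4 := hpsum i hi.le
    have h4' := hpsum (i + 1) hi
    have h5 : (i + 1) ^ k ≤ U ^ k := Nat.pow_le_pow_left (by omega) k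
    have hok : ∀ b' : State, b'.reg 44 = i → ((Expr.var 44 + .lit 1).pow k).Ok B b' := by
      intro b' hb'
      refine Expr.Ok.pow (b := U) ?_ ?_ (by omega) (by omega)
      · simp only [Expr.ok_add, Expr.ok_var, Expr.ok_lit, Expr.eval_var, Expr.eval_lit, hb']
        omega
      · simp [hb']; omega
    have e1 : b.reg 45 + b.mem (b.reg 40 + b.reg 44) = ∑ j ∈ range (i + 1), bitAt x j := by
      rw [sum_range_succ, h45, hmem, hb40, h44, hx i hi]
    have h6 := hacc (i + 1)
    refine Runs.mono_time (T := _) (Runs.assign_seq (by norm_num) ?_ <|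
      Runs.assign_seq (by norm_num) ?_ <| Runs.assign (by norm_num) ?_ ?_) ?_
    · simp only [Expr.ok_add, Expr.ok_var, Expr.ok_mem, Expr.eval_var, Expr.eval_mem, Expr.eval_add,
        e1]
      rw [h44, hb40, h45, hmem, hx i hi]
      omega
    · simp only [Expr.ok_add, Expr.ok_mul, Expr.ok_var, Expr.eval_var, Expr.eval_mem, Expr.eval_add,
        Expr.eval_lit, Expr.eval_mul, Expr.eval_pow, e1, State.reg_set]
      simp only [h44, h46, reduceIte, Nat.reduceEqDiff]
      rw [sum_range_succ] at h3'
      refine ⟨⟨⟨by norm_num, by omega⟩, ⟨hok _ (by simp [h44]), by norm_num, by omega⟩, by omega⟩,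
        by omega⟩
    · simp only [Expr.ok_add, Expr.ok_var, Expr.eval_var, Expr.eval_mem, Expr.eval_add,
        Expr.eval_lit, Expr.eval_pow, State.reg_set]
      simp only [h44, h47, reduceIte, Nat.reduceEqDiff]
      rw [sum_range_succ] at h4'
      exact ⟨⟨⟨by norm_num, by omega⟩, hok _ (by simp [h44])⟩, by omega⟩
    · refine ⟨by simp [h44], (((hb.set ?_).set ?_).set ?_).set ?_, ?_⟩ <;> try norm_num
      simp only [hmem, h44, h46, h47, sum_range_succ _ i, true_and, h45]
      rw [← hx i hi, ← hb40, ← h44, ← hmem]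
      simp [hmem, hb40, h44, hx i hi]
    · simp; ring_nf; omega
  · refine ⟨(((SameRegs.refl.set ?_).set ?_).set ?_).set ?_, ?_⟩ <;> simp
  · rintro b ⟨⟨h1, h2, h3, h4, h5⟩, -⟩
    have := hsum x.length le_rfl
    exact ⟨h1, h2, by rw [h4, VT_accum], by omega, h5⟩
  · simp; ring_nf; omega

/-- Compute `⌈log₂ R[52]⌉` in `R[48]`. -/
def clogProgram : Program :=
  .seq (assign 48 (.lit 0)) <| .seq (assign 49 (.lit 1)) <| .whileLt 49 52 <|
    .seq (assign 49 (.var 49 + .var 49)) (assign 48 (.var 48 + .lit 1))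

/-- The power `2 ^ i` is below `R[52]` exactly for `i` below the rounded logarithm, which fixes the
number of rounds. The last doubling stays below `2 R[52]`, whence the bound on `B`. -/
theorem runs_clogProgram {B : ℕ} {a : State} (hB : 2 * a.reg 52 < B) (ha : 0 < a.reg 52) :
    Runs B clogProgram a (Nat.clog 2 (a.reg 52) * 14 + 7) fun b =>
      SameRegs 48 a b ∧ b.reg 51 = a.reg 51 ∧ b.mem = a.mem ∧
        b.reg 48 = Nat.clog 2 (a.reg 52) := by
  refine Runs.mono_time (T := _) (Runs.assign_seq (by norm_num) (show 0 < B by omega) <|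
    Runs.assign_seq (by norm_num) (show 1 < B by omega) <|
    (Runs.whileLt (T := 13) (N := Nat.clog 2 (a.reg 52))
      (I := fun i b => SameRegs 48 a b ∧ b.mem = a.mem ∧ b.reg 48 = i ∧ b.reg 49 = 2 ^ i ∧
        b.reg 51 = a.reg 51 ∧ b.reg 52 = a.reg 52)
      (by norm_num) (by norm_num) ?_ ?_ ?_).mono le_rfl ?_) ?_
  · rintro i hi b ⟨hb, hmem, h48, h49, h51, h52⟩
    have h1 : 2 ^ i < a.reg 52 := (Nat.lt_clog_iff_pow_lt (by norm_num)).1 hi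
    have h2 : i < 2 ^ i := Nat.lt_two_pow_self
    refine ⟨by omega, Runs.mono_time (T := _) (Runs.assign_seq (by norm_num) ?_ <|
      Runs.assign (by norm_num) ?_ ?_) ?_⟩
    · simp only [Expr.ok_add, Expr.ok_var, Expr.eval_var, h49]
      omega
    · simp only [Expr.ok_add, Expr.ok_var, Expr.ok_lit, Expr.eval_var, Expr.eval_lit, State.reg_set]
      simp only [h48, reduceIte, Nat.reduceEqDiff]
      omega
    · refine ⟨(hb.set ?_).set ?_, ?_⟩ <;> simp [hmem, h48, h49, h51, h52, pow_succ, mul_two]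
    · simp
  · rintro b ⟨hb, hmem, h48, h49, h51, h52⟩
    rw [h49, h52, not_lt]
    exact Nat.le_pow_clog (by norm_num) _
  · refine ⟨(SameRegs.refl.set ?_).set ?_, ?_⟩ <;> simp
  · rintro b ⟨h1, h2, h3, h4, h5, h6⟩
    exact ⟨h1, h5, h2, h3⟩
  · simp; omega

/-- Write the binary representation of `R[51]` with `R[48]` digits from the address `R[42] + R[43]`
on. -/
def digitsProgram : Program :=
  forLoop 50 48 <|
    .seq (storeAt (.var 42 + .var 43 + .var 48 - .lit 1 - .var 50) (.var 51 % .lit 2)) <|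
    assign 51 (.var 51 / .lit 2)

/-- Halving produces the least significant digit first, so the digits are written from right to
left. -/
theorem runs_digitsProgram {B p f w : ℕ} {a : State} (hp : a.reg 42 + a.reg 43 = p)
    (h48 : a.reg 48 = w) (h51 : a.reg 51 = f) (hB : p + w + 2 < B) (hf : f < B) :
    Runs B digitsProgram a (w * 32 + 4) fun b =>
      SameRegs 50 a b ∧ Holds b.mem p (binary w f) ∧ ∀ i < p, b.mem i = a.mem i := by
  refine Runs.mono_time (T := _) ((Runs.forLoop (T := 25) (N := w)
    (I := fun i b => SameRegs 50 a b ∧ b.reg 51 = f / 2 ^ i ∧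
      (∀ j < i, j < w → b.mem (p + (w - 1 - j)) = f / 2 ^ j % 2) ∧ ∀ i < p, b.mem i = a.mem i)
    (by norm_num) (by norm_num) (by omega) ?_ ?_ ?_).mono le_rfl ?_) ?_
  · rintro i b ⟨hb, -⟩
    rw [hb 48 (by norm_num), h48]
  · rintro i hi b ⟨hb, hb51, hmem, hlow⟩ h50
    have h1 : f / 2 ^ i ≤ f := Nat.div_le_self _ _
    have hb42 := hb 42 (by norm_num)
    have hb43 := hb 43 (by norm_num)
    have hb48 := hb 48 (by norm_num)
    refine Runs.mono_time (T := _) (Runs.storeAt_seq ?_ ?_ <| Runs.assign (by norm_num) ?_ ?_) ?_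
    · simp only [Expr.ok_add, Expr.ok_sub, Expr.ok_var, Expr.ok_lit, Expr.eval_var, Expr.eval_add,
        hb42, hb43, hb48, h50]
      omega
    · simp only [Expr.ok_mod, Expr.ok_var, Expr.ok_lit, hb51]
      omega
    · simp only [Expr.ok_div, Expr.ok_var, Expr.ok_lit, State.reg_write, hb51]
      omega
    · refine ⟨by simp [h50], (hb.write.set ?_).set ?_, ?_, ?_, ?_⟩
      · norm_num
      · norm_num
      · simp [hb51, pow_succ, Nat.div_div_eq_div_mul]
      · intro j hj hjw
        simp only [Expr.eval_sub, Expr.eval_add, Expr.eval_var, Expr.eval_lit, Expr.eval_mod,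
          State.mem_set, State.mem_write, hb42, hb43, hb48, h50, hb51, h48, hp]
        rcases Nat.lt_succ_iff_lt_or_eq.1 hj with hj | rfl
        · rw [if_neg (by omega), hmem j hj hjw]
        · rw [if_pos (by omega)]
      · intro j hj
        simp only [Expr.eval_sub, Expr.eval_add, Expr.eval_var, Expr.eval_lit, Expr.eval_mod,
          State.mem_set, State.mem_write, hb42, hb43, hb48, h50, hb51, h48, hp]
        rw [if_neg (by omega), hlow j hj]
    · simp
  · refine ⟨SameRegs.refl.set ?_, ?_⟩ <;> simp [h51]
  · rintro b ⟨⟨hb, hb51, hmem, hlow⟩, -⟩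
    refine ⟨hb, fun i hi => ?_, hlow⟩
    rw [length_binary] at hi
    have h1 := hmem (w - 1 - i) (by omega) (by omega)
    have h2 := bitAt_binary (w := w) (m := f) (j := w - 1 - i) (by omega)
    rw [show w - 1 - (w - 1 - i) = i by omega] at h1 h2
    rw [h1, h2]
  · omega

/-- Write the syndrome of order `k` from the address `R[42] + R[43]` on, and advance `R[43]`. -/
def syndromeProgram (s k : ℕ) : Program :=
  .seq (vtProgram k) <| .seq (assign 52 (.lit (2 * s + 1) * .var 47 + .lit 1)) <|
    .seq (assign 51 (.var 46 % .var 52)) <| .seq clogProgram <| .seq digitsProgram <|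
    assign 43 (.var 43 + .var 48)

/-- The modulus is at most `U ^ (2 s + 2)`; the two further powers in the bound on `B` absorb the
doubling in `clogProgram` and the unreduced syndrome. -/
theorem runs_syndromeProgram {B U s k src : ℕ} {x : List Bool} {a : State}
    (hx : Holds a.mem src x) (h40 : a.reg 40 = src) (h41 : a.reg 41 = x.length)
    (hlen : 0 < x.length) (hk : k ≤ 2 * s)
    (hU : a.reg 42 + a.reg 43 + (Fbk s k x).length + 2 * s + 3 ≤ U)
    (hsrc : src + x.length ≤ a.reg 42) (hB : U ^ (2 * s + 4) ≤ B) :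
    Runs B (syndromeProgram s k) a (x.length * (220 * s + 300)) fun b =>
      SameRegs 43 a b ∧ b.reg 43 = a.reg 43 + (Fbk s k x).length ∧
      Holds b.mem (a.reg 42 + a.reg 43) (Fbk s k x) ∧
      ∀ i < a.reg 42 + a.reg 43, b.mem i = a.mem i := by
  have hsum : ∑ i ∈ Finset.Icc 1 x.length, i ^ k = ∑ i ∈ Finset.range x.length, (i + 1) ^ k := by
    rw [Finset.range_eq_Ico, Finset.sum_Ico_add' (fun i => i ^ k) 0 x.length 1]
    rfl
  have hM : (2 * s + 1) * (∑ i ∈ Finset.range x.length, (i + 1) ^ k) + 1 =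
      modulus s k x.length := by rw [modulus, hsum]
  have hU0 : 0 < U := by omega
  have hlenU : x.length ≤ U := by omega
  have hMle : modulus s k x.length ≤ U ^ (2 * s + 2) := by
    refine (modulus_le s k hlen).trans ?_
    rw [pow_succ U (2 * s + 1), mul_comm]
    refine Nat.mul_le_mul ((Nat.pow_le_pow_left hlenU _).trans
      (Nat.pow_le_pow_right hU0 (by omega))) (by omega)
  have hMU : 2 * U ^ (2 * s + 2) ≤ U ^ (2 * s + 3) := by
    rw [pow_succ U (2 * s + 2), mul_comm]
    exact Nat.mul_le_mul_left _ (by omega)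
  have hMU' : 2 * U ^ (2 * s + 3) ≤ U ^ (2 * s + 4) := by
    rw [pow_succ U (2 * s + 3), mul_comm]
    exact Nat.mul_le_mul_left _ (by omega)
  have hUU : U ≤ U ^ (2 * s + 2) := Nat.le_self_pow (by omega) U
  have hM0 : 0 < modulus s k x.length := by simp [modulus]
  have hclog := clog_modulus_le hk hlen
  have hFlt := F_lt s k x
  rw [length_Fbk] at hU ⊢
  set c := Nat.clog 2 (modulus s k x.length) with hc
  refine Runs.mono_time (Runs.seq (U := 8 + (7 + ((c * 14 + 7) + ((c * 32 + 4) + 7)))) <|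
    (runs_vtProgram (U := U) hx h40 h41 (by omega)
      ((Nat.pow_le_pow_right hU0 (by omega)).trans hB)).mono le_rfl ?_) ?_
  · rintro b ⟨hb, hbmem, h46, h46B, h47⟩
    have e52 : (Expr.lit (2 * s + 1) * .var 47 + .lit 1).eval b = modulus s k x.length := by
      simp [h47, hM]
    refine Runs.assign_seq (by norm_num) ?_ ?_
    · have h1 : (2 * s + 1) * b.reg 47 + 1 = modulus s k x.length := by rw [h47, hM]
      have h2 : b.reg 47 ≤ (2 * s + 1) * b.reg 47 := Nat.le_mul_of_pos_left _ (by omega)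
      simp only [Expr.ok_add, Expr.ok_mul, Expr.ok_lit, Expr.ok_var, Expr.eval_mul, Expr.eval_var,
        Expr.eval_lit]
      omega
    rw [e52]
    refine Runs.assign_seq (by norm_num) ?_ ?_
    · simp only [Expr.ok_mod, Expr.ok_var, State.reg_set, reduceIte, Nat.reduceEqDiff]
      omega
    have e51 : (Expr.var 46 % .var 52).eval (b.set 52 (modulus s k x.length)) = F s k x := by
      simp [h46, F]
    rw [e51]
    have h52 : ((b.set 52 (modulus s k x.length)).set 51 (F s k x)).reg 52 =
      modulus s k x.length := by simp
    refine Runs.seq ((runs_clogProgram (by rw [h52]; omega) (by rw [h52]; omega)).mono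
      (by rw [h52]) ?_)
    rintro b' ⟨hb', h51, hmem', h48⟩
    rw [h52, ← hc] at h48
    have hab' : SameRegs 44 a b' :=
      (hb.set (by norm_num)).set (by norm_num) |>.trans (hb'.mono (by norm_num))
    have hb42 := hab' 42 (by norm_num)
    have hb43 := hab' 43 (by norm_num)
    refine Runs.seq ((runs_digitsProgram (p := a.reg 42 + a.reg 43) (f := F s k x) (w := c)
      (by rw [hb42, hb43]) h48 (by rw [h51]; simp) (by omega) (by omega)).mono le_rfl ?_)
    rintro d ⟨hd, hdF, hdlow⟩
    have hd43 := hd 43 (by norm_num)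
    have hd48 := hd 48 (by norm_num)
    have e43 : (Expr.var 43 + .var 48).eval d = a.reg 43 + c := by
      simp [hd43, hd48, hb43, h48]
    refine Runs.assign (by norm_num) ?_ ?_
    · simp only [Expr.ok_add, Expr.ok_var, Expr.eval_var]
      omega
    rw [e43]
    refine ⟨((hab'.trans (hd.mono (by norm_num))).mono (by norm_num)).set le_rfl, by simp, hdF, ?_⟩
    intro i hi
    rw [State.mem_set, hdlow i hi, hmem', State.mem_set, State.mem_set, hbmem]
  · have h1 : x.length * (10 * k) ≤ x.length * (10 * (2 * s)) := Nat.mul_le_mul_left _ (by omega)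
    nlinarith

/-- Write the syndromes of order below `m`. -/
def syndromesProgram (s : ℕ) : ℕ → Program
  | 0 => assign 43 (.lit 0)
  | m + 1 => .seq (syndromesProgram s m) (syndromeProgram s m)

theorem runs_syndromesProgram {B U s src : ℕ} {x : List Bool} {a : State}
    (hx : Holds a.mem src x) (h40 : a.reg 40 = src) (h41 : a.reg 41 = x.length)
    (hlen : 0 < x.length) (hU : a.reg 42 + syndromeLength s x.length + 2 * s + 3 ≤ U)
    (hsrc : src + x.length ≤ a.reg 42) (hB : U ^ (2 * s + 4) ≤ B) (m : ℕ) (hm : m ≤ 2 * s + 1) :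
    Runs B (syndromesProgram s m) a (m * (x.length * (220 * s + 300)) + 3) fun b =>
      SameRegs 43 a b ∧
      b.reg 43 = ((List.range m).flatMap fun k => Fbk s k x).length ∧
      Holds b.mem (a.reg 42) ((List.range m).flatMap fun k => Fbk s k x) ∧
      ∀ i < a.reg 42, b.mem i = a.mem i := by
  have hUB : U ≤ B := (Nat.le_self_pow (by omega) U).trans hB
  induction m with
  | zero =>
    refine Runs.mono_time (Runs.assign (by norm_num) (show 0 < B by omega) ?_) (by simp)
    exact ⟨SameRegs.refl.set le_rfl, by simp, fun i hi => by simp at hi, fun _ _ => rfl⟩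
  | succ m ih =>
    refine Runs.mono_time (Runs.seq (U := x.length * (220 * s + 300)) <|
      (ih (by omega)).mono le_rfl ?_)
      (U := (m + 1) * (x.length * (220 * s + 300)) + 3) (by rw [add_mul]; omega)
    rintro b ⟨hb, h43, hF, hlow⟩
    have hb40 := hb 40 (by norm_num)
    have hb41 := hb 41 (by norm_num)
    have hb42 := hb 42 (by norm_num)
    have hle : ((List.range m).flatMap fun k => Fbk s k x).length + (Fbk s m x).length ≤
        syndromeLength s x.length := by
      rw [length_flatMap_range, ← Finset.sum_range_succ (fun k => (Fbk s k x).length)]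
      simp only [length_Fbk]
      exact Finset.sum_le_sum_of_subset (Finset.range_mono hm)
    refine (runs_syndromeProgram (U := U) (x := x) (src := src)
      (hx.congr fun i hi => hlow _ (by omega)) (by omega) (by omega) hlen (by omega) ?_ (by omega)
      hB).mono le_rfl ?_
    · rw [hb42, h43]; omega
    rintro c ⟨hc, hc43, hcF, hclow⟩
    rw [hb42] at hcF hclow
    rw [List.range_succ, List.flatMap_append]
    refine ⟨hb.trans hc, ?_, ?_, ?_⟩
    · rw [hc43, h43]; simp
    · refine (hF.congr fun i hi => hclow _ (by omega)).append ?_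
      simpa [h43] using hcF
    · intro i hi
      rw [hclow i (by omega), hlow i hi]

/-- Write the syndromes of the word of length `len` at the address `src` from the address `dst`
on. -/
def fbProgram (s : ℕ) (src len dst : Expr) : Program :=
  .seq (assign 40 src) <| .seq (assign 41 len) <| .seq (assign 42 dst) <|
    syndromesProgram s (2 * s + 1)

/-- The expressions are evaluated one after the other, so each hypothesis refers to the state after
the preceding assignments. -/
theorem runs_fbProgram {B U s p : ℕ} {x : List Bool} {a : State} {src len dst : Expr}
    (hsrc : src.Ok B a) (hlen : len.Ok B (a.set 40 (src.eval a)))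
    (hdst : dst.Ok B ((a.set 40 (src.eval a)).set 41 x.length))
    (hlenx : len.eval (a.set 40 (src.eval a)) = x.length)
    (hdstp : dst.eval ((a.set 40 (src.eval a)).set 41 x.length) = p)
    (hx : Holds a.mem (src.eval a) x) (hx0 : 0 < x.length) (hle : src.eval a + x.length ≤ p)
    (hU : p + syndromeLength s x.length + 2 * s + 3 ≤ U) (hB : U ^ (2 * s + 4) ≤ B) :
    Runs B (fbProgram s src len dst) a
      (src.cost + len.cost + dst.cost + x.length * (300 * (2 * s + 1) ^ 2) + 9) fun b =>
      SameRegs 40 a b ∧ b.reg 43 = syndromeLength s x.length ∧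
      Holds b.mem p (Fb s x) ∧ ∀ i < p, b.mem i = a.mem i := by
  refine Runs.mono_time (T := _) (Runs.assign_seq (by norm_num) hsrc <|
    Runs.assign_seq (by norm_num) hlen ?_) (?_ : src.cost + 2 + (len.cost + 2 + (dst.cost + 2 +
      ((2 * s + 1) * (x.length * (220 * s + 300)) + 3))) ≤ _)
  · rw [hlenx]
    refine Runs.assign_seq (by norm_num) hdst ?_
    rw [hdstp]
    refine (runs_syndromesProgram (U := U) (x := x) (src := src.eval a) ?_ (by simp) (by simp) hx0
      (by simpa using hU) (by simpa using hle) hB _ le_rfl).mono le_rfl ?_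
    · exact hx
    rintro b ⟨hb, h43, hF, hlow⟩
    refine ⟨?_, ?_, ?_, ?_⟩
    · exact (((SameRegs.refl.set (by norm_num)).set (by norm_num)).set (by norm_num)).trans
        (hb.mono (by norm_num))
    · rw [h43]; exact length_Fb s x
    · simpa [Fb] using hF
    · simpa using hlow
  · nlinarith [Nat.zero_le (x.length * s), Nat.zero_le (x.length * s * s)]

/-! ### The encoding program -/

theorem holds_init (n : ℕ) (u : List Bool) : Holds (init n u).mem 0 u := by
  intro i _
  simp [init, bitAt]

theorem hasOutput_of_holds {σ : State} {v : List Bool} (h0 : σ.reg 0 = v.length)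
    (h : Holds σ.mem 0 v) : σ.HasOutput v := by
  refine ⟨h0, fun i hi => ?_⟩
  have := h i hi
  rw [zero_add] at this
  rw [this]
  simp [bitAt, hi]

theorem Runs.runsIn {B T n w : ℕ} {p : Program} {u v : List Bool}
    (h : Runs B p (init n u) T fun b => b.HasOutput v) (hw : B ≤ 2 ^ w) (hn : n < B)
    (hu : u.length < B) : RunsIn p w n u v T := by
  obtain ⟨t, ht, τ, b, h1, h2, h3⟩ := h w hw (init n u) ⟨fun _ _ => rfl, rfl⟩
  refine ⟨by omega, by omega, t, ht, τ, h1, (h2.1 0 (by norm_num)).trans h3.1, ?_⟩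
  rw [h2.2]
  exact h3.2

/-- A fixed power of a linear function of `n` fits into `O(log n)` bits. The constant `c` is bounded
crudely by `2 ^ c`. -/
theorem exists_word_length (c e : ℕ) :
    ∃ a, ∀ n : ℕ, (c * n) ^ e ≤ 2 ^ (a * (Nat.log 2 n + 1)) := by
  refine ⟨(c + 1) * e, fun n => ?_⟩
  have h1 : n ≤ 2 ^ (Nat.log 2 n + 1) := (Nat.lt_pow_succ_log_self (by norm_num) n).le
  have h2 : c ≤ 2 ^ (c * (Nat.log 2 n + 1)) :=
    Nat.lt_two_pow_self.le.trans (Nat.pow_le_pow_right (by norm_num) (Nat.le_mul_of_pos_right _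
      (Nat.succ_pos _)))
  calc (c * n) ^ e ≤ (2 ^ (c * (Nat.log 2 n + 1)) * 2 ^ (Nat.log 2 n + 1)) ^ e :=
        Nat.pow_le_pow_left (Nat.mul_le_mul h2 h1) e
    _ = 2 ^ ((c + 1) * e * (Nat.log 2 n + 1)) := by
        rw [← pow_add, ← pow_mul]; congr 1; ring

theorem bitAt_repetition {r : ℕ} (hr : 0 < r) (z : List Bool) (i : ℕ) :
    bitAt (repetition r z) i = bitAt z (i / r) := by
  have h := getElem?_repetition z (i / r) (Nat.mod_lt i hr)
  rw [Nat.div_add_mod] at h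
  simp only [bitAt, List.getD_eq_getElem?_getD, h]

/-- The encoder: `R[2]` and `R[3]` are the numbers of bits of `Fb s x` and `Fb s (Fb s x)`. -/
def encodeProgram (s : ℕ) : Program :=
  .seq (fbProgram s (.lit 0) (.var 0) (.var 0)) <| .seq (assign 2 (.var 43)) <|
  .seq (fbProgram s (.var 0) (.var 2) (.var 0 + .var 2)) <| .seq (assign 3 (.var 43)) <|
  .seq (assign 4 (.var 0 + .var 2)) <| .seq (assign 5 (.lit (2 * s + 2) * .var 3)) <|
  .seq (fbProgram s (.var 0) (.var 2) (.var 4 + .var 5)) <|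
  .seq (forLoop 6 5
    (storeAt (.var 4 + .var 6) (.mem (.var 4 + .var 5 + .var 6 / .lit (2 * s + 2))))) <|
  assign 0 (.var 4 + .var 5)

theorem runs_encodeProgram {B U s : ℕ} {x : List Bool} (hx0 : 0 < x.length)
    (hU : codeLength s x.length + syndromeLength s (syndromeLength s x.length) + 2 * s + 3 ≤ U)
    (hB : U ^ (2 * s + 4) ≤ B) :
    Runs B (encodeProgram s) (init x.length x)
      (x.length * (300 * (2 * s + 1) ^ 2) +
        2 * (syndromeLength s x.length * (300 * (2 * s + 1) ^ 2)) +
        (2 * s + 2) * syndromeLength s (syndromeLength s x.length) * 24 + 86)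
      fun b => b.HasOutput (encode s x) := by
  have hUB : U ≤ B := (Nat.le_self_pow (by omega) U).trans hB
  set n := x.length with hn
  set m := syndromeLength s n with hm
  set m' := syndromeLength s m with hm'
  have hm0 : 0 < m := syndromeLength_pos s hx0
  rw [codeLength, ← hm, ← hm'] at hU
  have hmm' : m' ≤ (2 * s + 2) * m' := Nat.le_mul_of_pos_left _ (by omega)
  obtain ⟨R, hR⟩ : ∃ R, (2 * s + 2) * m' = R := ⟨_, rfl⟩
  rw [hR] at hU hmm' ⊢
  have hlenF : (Fb s x).length = m := length_Fb s x
  have hlenFF : (Fb s (Fb s x)).length = m' := by rw [length_Fb, hlenF]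
  have i0 : (init n x).reg 0 = n := rfl
  refine Runs.mono_time (Runs.seq (U := 4 + (m * (300 * (2 * s + 1) ^ 2) + 18 + (4 + (7 + (6 +
    (m * (300 * (2 * s + 1) ^ 2) + 18 + ((R * 24 + 4) + 7))))))) <|
    (runs_fbProgram (U := U) (x := x) (p := n) (src := .lit 0) (by simp; omega) ?_ ?_ ?_ ?_
      (holds_init n x) hx0 ?_ ?_ hB).mono le_rfl ?_) ?_
  · simp [i0]; omega
  · simp [i0]; omega
  · simp [i0]; exact hn
  · simp [i0]
  · simp; omega
  · rw [← hn, ← hm]; omega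
  · rintro b ⟨hb, hb43, hbF, hblow⟩
    rw [← hn, ← hm] at hb43
    have hb0 : b.reg 0 = n := hb 0 (by norm_num)
    have hbx : Holds b.mem 0 x := (holds_init n x).congr fun i hi => hblow _ (by omega)
    refine Runs.assign_seq (by norm_num) ⟨by norm_num, by omega⟩ ?_
    rw [Expr.eval_var, hb43]
    -- This evaluation of `Fb s (Fb s x)` only finds its length; the bits are later overwritten by
    -- the repetition.
    refine Runs.seq ((runs_fbProgram (U := U) (x := Fb s x) (p := n + m) ?_ ?_ ?_ ?_ ?_ ?_ ?_ ?_ ?_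
      hB).mono (by simp [hlenF]; omega) ?_)
    · simp [hb0]; omega
    · simp; omega
    · simp [hb0]; omega
    · simp [hlenF]
    · simp [hb0]
    · simpa [hb0] using hbF
    · omega
    · simp [hb0, hlenF]
    · rw [hlenF, ← hm']; omega
    rintro c ⟨hc, hc43, hcF, hclow⟩
    rw [hlenF, ← hm'] at hc43
    have hc0 : c.reg 0 = n := by rw [hc 0 (by norm_num)]; simp [hb0]
    have hc2 : c.reg 2 = m := by rw [hc 2 (by norm_num)]; simp
    have hcx : Holds c.mem 0 x := hbx.congr fun i hi => hclow _ (by omega)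
    have hcFb : Holds c.mem n (Fb s x) := hbF.congr fun i hi => hclow _ (by omega)
    refine Runs.assign_seq (by norm_num) ⟨by norm_num, by omega⟩ ?_
    rw [Expr.eval_var, hc43]
    refine Runs.assign_seq (by norm_num) ?_ ?_
    · simp [hc0, hc2]; omega
    have e4 : (Expr.var 0 + .var 2).eval (c.set 3 m') = n + m := by simp [hc0, hc2]
    rw [e4]
    refine Runs.assign_seq (by norm_num) ?_ ?_
    · simp [hR]; omega
    have e5 : (Expr.lit (2 * s + 2) * .var 3).eval ((c.set 3 m').set 4 (n + m)) = R := by simp [hR]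
    rw [e5]
    -- The second evaluation is placed past the end of the codeword, so the repetition loop never
    -- overwrites a bit that it still has to read.
    refine Runs.seq ((runs_fbProgram (U := U) (x := Fb s x) (p := n + m + R) ?_ ?_ ?_ ?_ ?_ ?_
      ?_ ?_ ?_ hB).mono (by simp [hlenF]; omega) ?_)
    · simp [hc0]; omega
    · simp [hc2]; omega
    · simp; omega
    · simp [hlenF, hc2]
    · simp
    · simpa [hc0] using hcFb
    · omega
    · simp [hc0, hlenF]
    · rw [hlenF, ← hm']; omega
    rintro d ⟨hd, hd43, hdF, hdlow⟩
    have hd4 : d.reg 4 = n + m := by rw [hd 4 (by norm_num)]; simp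
    have hd5 : d.reg 5 = R := by rw [hd 5 (by norm_num)]; simp
    have hdx : Holds d.mem 0 x := hcx.congr fun i hi => hdlow _ (by omega)
    have hdFb : Holds d.mem n (Fb s x) := hcFb.congr fun i hi => hdlow _ (by omega)
    refine Runs.seq ((Runs.forLoop (T := 17) (N := R)
      (I := fun i e => e.reg 4 = n + m ∧ e.reg 5 = R ∧ (∀ j < n + m, e.mem j = d.mem j) ∧
        (∀ j < i, e.mem (n + m + j) = bitAt (Fb s (Fb s x)) (j / (2 * s + 2))) ∧
        Holds e.mem (n + m + R) (Fb s (Fb s x)))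
      (by norm_num) (by norm_num) (by omega) ?_ ?_ ?_).mono le_rfl ?_)
    · exact fun i e he => he.2.1
    · rintro i hi e ⟨he4, he5, helow, hebit, heF⟩ he6
      have hdiv : i / (2 * s + 2) < m' := Nat.div_lt_of_lt_mul (hR ▸ hi)
      have hb1 := bitAt_le_one (Fb s (Fb s x)) (i / (2 * s + 2))
      have h1 := heF (i / (2 * s + 2)) (by omega)
      refine Runs.mono_time (Runs.storeAt ?_ ?_ ?_) ?_
      · simp [he4, he6]; omega
      · simp [he4, he5, he6, h1]; omega
      · refine ⟨by simp [he6], by simp [he4], by simp [he5], ?_, ?_, ?_⟩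
        · intro j hj
          simp only [Expr.eval_add, Expr.eval_var, State.mem_set, State.mem_write, he4, he6]
          rw [if_neg (by omega), helow j hj]
        · intro j hj
          simp only [Expr.eval_add, Expr.eval_var, Expr.eval_mem, Expr.eval_div, Expr.eval_lit,
            State.mem_set, State.mem_write, he4, he5, he6, h1]
          rcases Nat.lt_succ_iff_lt_or_eq.1 hj with hj | rfl
          · rw [if_neg (by omega), hebit j hj]
          · rw [if_pos rfl]
        · refine heF.congr fun j hj => ?_
          simp only [Expr.eval_add, Expr.eval_var, State.mem_set, State.mem_write, he4, he6]
          rw [if_neg (by omega)]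
      · simp
    · exact ⟨by simp [hd4], by simp [hd5], fun _ _ => rfl,
        fun j hj => absurd hj (Nat.not_lt_zero j), hdF⟩
    · rintro e ⟨⟨he4, he5, helow, hebit, -⟩, -⟩
      refine Runs.assign (by norm_num) ?_ ?_
      · simp [he4, he5]; omega
      · have hlen : (encode s x).length = n + m + R := by
          rw [length_encode, codeLength, ← hn, ← hm, ← hm', hR]
        refine hasOutput_of_holds (by simp [hlen, he4, he5]) ?_
        rw [encode]
        refine Holds.append (Holds.append ?_ ?_) ?_
        · exact hdx.congr fun i hi => helow _ (by omega)
        · rw [zero_add]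
          exact hdFb.congr fun i hi => helow _ (by omega)
        · intro i hi
          rw [length_repetition, hlenFF, hR] at hi
          rw [bitAt_repetition (by omega), List.length_append, hlenF, zero_add]
          exact hebit i hi
  · simp [← hn]; omega

/-- The factor by which a word is shorter than its syndromes, at most. -/
def syndromeFactor (s : ℕ) : ℕ := (2 * s + 1) * (4 * s + 4)

theorem codeLength_le (s : ℕ) {n : ℕ} (hn : 0 < n) :
    codeLength s n + syndromeLength s (syndromeLength s n) + 2 * s + 3 ≤
      (1 + syndromeFactor s + (2 * s + 3) * syndromeFactor s ^ 2 + 2 * s + 3) * n := by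
  have h1 : syndromeLength s n ≤ syndromeFactor s * n := syndromeLength_le s hn
  have h2 : syndromeLength s (syndromeLength s n) ≤ syndromeFactor s * syndromeLength s n :=
    syndromeLength_le s (syndromeLength_pos s hn)
  have h3 : syndromeLength s (syndromeLength s n) ≤ syndromeFactor s ^ 2 * n :=
    h2.trans ((Nat.mul_le_mul_left _ h1).trans_eq (by ring))
  have h4 := Nat.mul_le_mul_left (2 * s + 3) h3
  have h5 : 2 * s + 3 ≤ (2 * s + 3) * n := Nat.le_mul_of_pos_right _ hn
  unfold codeLength
  linarith

theorem exists_encodeProgram (s : ℕ) : ∃ (p : Program) (a K : ℕ), ∀ n : ℕ, 1 ≤ n →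
    ∀ x : List Bool, x.length = n →
      RunsIn p (a * (Nat.log 2 n + 1)) n x (encode s x) (K * n) := by
  set c := 1 + syndromeFactor s + (2 * s + 3) * syndromeFactor s ^ 2 + 2 * s + 3 with hc
  obtain ⟨a, ha⟩ := exists_word_length c (2 * s + 4)
  refine ⟨encodeProgram s, a, 300 * (2 * s + 1) ^ 2 +
    2 * (syndromeFactor s * (300 * (2 * s + 1) ^ 2)) + c * 24 + 86, ?_⟩
  rintro n hn x rfl
  have hU := codeLength_le s hn
  rw [← hc] at hU
  have hUB : c * x.length ≤ (c * x.length) ^ (2 * s + 4) := Nat.le_self_pow (by omega) _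
  have hlt : x.length < (c * x.length) ^ (2 * s + 4) := by
    have : x.length ≤ codeLength s x.length := by unfold codeLength; omega
    omega
  refine Runs.runsIn ((runs_encodeProgram hn hU le_rfl).mono_time ?_) (ha _) hlt hlt
  have h1 : syndromeLength s x.length ≤ syndromeFactor s * x.length := syndromeLength_le s hn
  have h2 := Nat.mul_le_mul_right (300 * (2 * s + 1) ^ 2) h1
  have h3 : (2 * s + 2) * syndromeLength s (syndromeLength s x.length) ≤ c * x.length := by
    unfold codeLength at hU
    omega
  nlinarith

end WordRAM

namespace DelSub

/-! ### The words with a given word in their ball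

The words of length `L` with a given word `y` in their single-deletion `s`-substitution ball are
enumerated by the numbers `c` with `s + 1` digits in base `2 L`: the digit `2 p + b` stands for the
bit `b` at the position `p`. The last digit tells where and which bit is inserted into `y`, and the
other digits tell which bits are then overwritten. -/

/-- Overwrite `q` bits of `x` as prescribed by the digits of `c` in base `m`. -/
def setDigits (m : ℕ) : ℕ → List Bool → ℕ → List Bool
  | 0, x, _ => x
  | q + 1, x, c => setDigits m q (x.set (c % m / 2) (decide (c % m % 2 = 1))) (c / m)

/-- The word with number `c`. -/
def candidate (s : ℕ) (y : List Bool) (c : ℕ) : List Bool :=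
  setDigits (2 * (y.length + 1)) s (y.insertIdx (c % (2 * (y.length + 1)) / 2)
    (decide (c % (2 * (y.length + 1)) % 2 = 1))) (c / (2 * (y.length + 1)))

theorem exists_skipIdx_eq {d j : ℕ} (h : j ≠ d) : ∃ i, skipIdx d i = j ∧ (j < d → i = j) ∧
    (d < j → i + 1 = j) := by
  rcases lt_or_gt_of_ne h with h | h
  · exact ⟨j, by simp [skipIdx, h], fun _ => rfl, fun h' => by omega⟩
  · exact ⟨j - 1, by unfold skipIdx; rw [if_neg (by omega)]; omega, fun h' => by omega,
      fun _ => by omega⟩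

theorem getElem?_insertIdx_skipIdx (y : List Bool) (d : ℕ) (b : Bool) (i : ℕ) :
    (y.insertIdx d b)[skipIdx d i]? = y[i]? := by
  rw [List.getElem?_insertIdx]
  unfold skipIdx
  by_cases h : i < d
  · simp [h]
  · rw [if_neg h, if_neg (by omega), if_neg (by omega), Nat.add_sub_cancel]

theorem near_insertIdx {y : List Bool} {d : ℕ} (b : Bool) (hd : d ≤ y.length) :
    Near 0 (y.insertIdx d b) y := by
  have hlen := List.length_insertIdx_of_le_length (a := b) hd
  refine ⟨hlen.symm, d, by omega, ?_⟩
  simp [mismatches, getElem?_insertIdx_skipIdx]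

-- By injectivity of `skipIdx`, an overwritten position is seen by at most one place of `y`.
open Finset in
theorem Near.set {q : ℕ} {x y : List Bool} (h : Near q x y) (p : ℕ) (b : Bool) :
    Near (q + 1) (x.set p b) y := by
  obtain ⟨h1, d, hd, h2⟩ := h
  refine ⟨by simpa using h1, d, by simpa using hd, ?_⟩
  have h3 : mismatches d (x.set p b) y ⊆
      mismatches d x y ∪ {j ∈ range y.length | skipIdx d j = p} := by
    intro j hj
    by_cases hjp : skipIdx d j = p
    · simp only [mismatches, mem_filter, mem_union] at hj ⊢
      exact Or.inr ⟨hj.1, hjp⟩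
    · simp only [mismatches, mem_filter, mem_union] at hj ⊢
      rw [List.getElem?_set_ne (Ne.symm hjp)] at hj
      exact Or.inl hj
  refine (card_le_card h3).trans ((card_union_le _ _).trans (Nat.add_le_add h2 (card_le_one.2 ?_)))
  intro i hi j hj
  simp only [mem_filter] at hi hj
  exact skipIdx_injective d (hi.2.trans hj.2.symm)

theorem Near.setDigits {m q r : ℕ} {x y : List Bool} (h : Near r x y) (c : ℕ) :
    Near (r + q) (setDigits m q x c) y := by
  induction q generalizing r x c with
  | zero => exact h
  | succ q ih =>
    have := ih (h.set (c % m / 2) (decide (c % m % 2 = 1))) (c / m)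
    rwa [add_right_comm] at this

/-- No candidate is a false one: with `Near.unique`, any candidate that has the right syndromes is
the wanted word. -/
theorem near_candidate (s : ℕ) (y : List Bool) (c : ℕ) : Near s (candidate s y c) y := by
  have hlt : c % (2 * (y.length + 1)) < 2 * (y.length + 1) := Nat.mod_lt _ (by omega)
  have h := (near_insertIdx (decide (c % (2 * (y.length + 1)) % 2 = 1))
    (show c % (2 * (y.length + 1)) / 2 ≤ y.length by omega)).setDigits
    (m := 2 * (y.length + 1)) (q := s) (c / (2 * (y.length + 1)))
  rwa [zero_add] at h

theorem exists_digit (m c p : ℕ) (b : Bool) (hp : 2 * p + 1 < m) :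
    ∃ c', c' % m / 2 = p ∧ decide (c' % m % 2 = 1) = b ∧ c' / m = c ∧ c' < m * (c + 1) := by
  have hb := b.toNat_le
  have hlt : 2 * p + b.toNat < m := by omega
  refine ⟨2 * p + b.toNat + m * c, ?_, ?_, ?_, ?_⟩
  · rw [Nat.add_mul_mod_self_left, Nat.mod_eq_of_lt hlt]; omega
  · rw [Nat.add_mul_mod_self_left, Nat.mod_eq_of_lt hlt]
    cases b <;> simp
  · rw [Nat.add_mul_div_left _ _ (by omega), Nat.div_eq_of_lt hlt, zero_add]
  · rw [mul_add]; omega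

-- Each digit repairs one wrong position. When none is left, the digit overwrites position 0 by the
-- bit that is already there, so exactly `q` digits always suffice.
open Finset in
theorem exists_setDigits_eq {q : ℕ} {x x' : List Bool} (hlen : x'.length = x.length)
    (hx : 0 < x.length) (h : #{j ∈ range x.length | x'[j]? ≠ x[j]?} ≤ q) :
    ∃ c < (2 * x.length) ^ q, setDigits (2 * x.length) q x' c = x := by
  induction q generalizing x' with
  | zero =>
    refine ⟨0, by simp, List.ext_getElem? fun j => ?_⟩
    rw [Nat.le_zero, card_eq_zero, filter_eq_empty_iff] at h
    by_cases hj : j < x.length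
    · exact not_not.1 (h (mem_range.2 hj))
    · change x'[j]? = x[j]?
      rw [List.getElem?_eq_none (by omega), List.getElem?_eq_none (by omega)]
  | succ q ih =>
    set T := {j ∈ range x.length | x'[j]? ≠ x[j]?} with hT
    obtain ⟨p, hp, hpT⟩ : ∃ p < x.length, #(T.erase p) ≤ q := by
      rcases T.eq_empty_or_nonempty with hT0 | ⟨p, hp⟩
      · exact ⟨0, hx, by simp [hT0]⟩
      · refine ⟨p, mem_range.1 (mem_filter.1 hp).1, ?_⟩
        rw [card_erase_of_mem hp]; omega
    obtain ⟨c, hc, hceq⟩ := ih (x' := x'.set p x[p]) (by simpa using hlen) (by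
      refine (card_le_card fun j hj => ?_).trans hpT
      simp only [mem_filter, mem_range] at hj
      by_cases hjp : p = j
      · subst hjp
        simp [hlen, hp] at hj
      · rw [List.getElem?_set_ne hjp] at hj
        exact mem_erase.2 ⟨Ne.symm hjp, mem_filter.2 ⟨mem_range.2 hj.1, hj.2⟩⟩)
    obtain ⟨c', h1, h2, h3, h4⟩ := exists_digit (2 * x.length) c p x[p] (by omega)
    refine ⟨c', h4.trans_le ?_, ?_⟩
    · rw [pow_succ, mul_comm]
      exact Nat.mul_le_mul_right _ hc
    · rw [setDigits, h1, h2, h3, hceq]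

-- Inserting the true symbol at the deleted position aligns `y` with `x`; the remaining errors are
-- the images of the mismatches under `skipIdx`, at most `s` of them.
open Finset in
theorem Near.exists_candidate_eq {s : ℕ} {x y : List Bool} (h : Near s x y) :
    ∃ c < (2 * x.length) ^ (s + 1), candidate s y c = x := by
  obtain ⟨h1, d, hd, h2⟩ := h
  have hlen : (y.insertIdx d x[d]).length = x.length := by
    rw [List.length_insertIdx_of_le_length (by omega), h1]
  obtain ⟨c, hc, hceq⟩ := exists_setDigits_eq (q := s) hlen (by omega) (by
    refine (card_le_card (t := (mismatches d x y).image (skipIdx d)) fun j hj => ?_).trans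
      (card_image_le.trans h2)
    simp only [mem_filter, mem_range] at hj
    have hjd : j ≠ d := by
      rintro rfl
      refine hj.2 ?_
      rw [List.getElem?_insertIdx]
      simp [hj.1, show j ≤ y.length by omega]
    obtain ⟨i, hi, h3, h4⟩ := exists_skipIdx_eq hjd
    refine mem_image.2 ⟨i, ?_, hi⟩
    have hij := hj.2
    rw [← hi, getElem?_insertIdx_skipIdx] at hij
    simp only [mismatches, mem_filter, mem_range]
    exact ⟨by omega, hij⟩)
  obtain ⟨c', h5, h6, h7, h8⟩ := exists_digit (2 * x.length) c d x[d] (by omega)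
  refine ⟨c', h8.trans_le ?_, ?_⟩
  · rw [pow_succ, mul_comm]
    exact Nat.mul_le_mul_right _ hc
  · rw [candidate, h1, h5, h6, h7, hceq]

end DelSub

namespace WordRAM

open DelSub

/-! ### Searching for a word with given syndromes

`R[20]` is the address of a word `y`, `R[21]` is `|y| + 1`, `R[22]` and `R[23]` are the address and
the length of the syndromes, and the result is written from the address `R[24]` on. -/

theorem bitAt_set (x : List Bool) {p : ℕ} (hp : p < x.length) (b : Bool) (i : ℕ) :
    bitAt (x.set p b) i = if i = p then b.toNat else bitAt x i := by
  by_cases h : i = p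
  · subst h; simp [bitAt, List.getD_eq_getElem?_getD, hp]
  · simp [bitAt, List.getD_eq_getElem?_getD, List.getElem?_set_ne (Ne.symm h), h]

theorem mod_two_eq_toNat (n : ℕ) : n % 2 = (decide (n % 2 = 1)).toNat := by
  rcases Nat.mod_two_eq_zero_or_one n with h | h <;> simp [h]

/-- Overwrite `q` bits of the word at the address `R[24]` as prescribed by the digits of `R[28]`. -/
def setDigitsProgram : ℕ → Program
  | 0 => .skip
  | q + 1 => .seq (assign 29 (.var 28 % (.lit 2 * .var 21))) <|
      .seq (assign 28 (.var 28 / (.lit 2 * .var 21))) <|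
      .seq (storeAt (.var 24 + .var 29 / .lit 2) (.var 29 % .lit 2)) (setDigitsProgram q)

theorem runs_setDigitsProgram {B scr : ℕ} (q : ℕ) {x : List Bool} {a : State}
    (h21 : a.reg 21 = x.length) (h24 : a.reg 24 = scr) (h28 : a.reg 28 < B) (hx0 : 0 < x.length)
    (hB : scr + 2 * x.length + 2 < B) (hx : Holds a.mem scr x) :
    Runs B (setDigitsProgram q) a (30 * q + 1) fun b =>
      SameRegs 28 a b ∧ Holds b.mem scr (setDigits (2 * x.length) q x (a.reg 28)) ∧
        ∀ i < scr, b.mem i = a.mem i := by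
  induction q generalizing x a with
  | zero => exact Runs.skip ⟨SameRegs.refl, hx, fun _ _ => rfl⟩
  | succ q ih =>
    have hdigit : a.reg 28 % (2 * x.length) < 2 * x.length := Nat.mod_lt _ (by omega)
    have hdiv : a.reg 28 / (2 * x.length) ≤ a.reg 28 := Nat.div_le_self _ _
    have hp : a.reg 28 % (2 * x.length) / 2 < x.length := by omega
    refine Runs.mono_time (Runs.assign_seq (by norm_num) ?_ <| Runs.assign_seq (by norm_num) ?_ <|
      Runs.storeAt_seq ?_ ?_ <| (ih (a := _)
        (x := x.set (a.reg 28 % (2 * x.length) / 2)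
          (decide (a.reg 28 % (2 * x.length) % 2 = 1))) ?_ ?_ ?_ ?_ ?_ ?_).mono le_rfl ?_) ?_
    · simp [h21]; omega
    · simp [h21]; omega
    · simp [h21, h24]; omega
    · simp [h21]; omega
    · simp [h21]
    · simp [h24]
    · simp [h21]; omega
    · simpa using hx0
    · simpa using hB
    · intro i hi
      rw [bitAt_set x hp]
      rw [List.length_set] at hi
      simp [h21, h24, ← mod_two_eq_toNat, hx i hi]
    · rintro b ⟨hb, hbx, hblow⟩
      refine ⟨(((SameRegs.refl.set ?_).set ?_).write).trans hb, ?_, ?_⟩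
      · norm_num
      · norm_num
      · simpa [setDigits, h21] using hbx
      · intro i hi
        rw [hblow i hi]
        simp only [Expr.eval_add, Expr.eval_var, Expr.eval_div, Expr.eval_lit, State.mem_set,
          State.mem_write, State.reg_set, reduceIte, Nat.reduceEqDiff, h24]
        rw [if_neg (by omega)]
    · simp; omega

/-- Write the candidate with number `R[28]` from the address `R[24]` on. -/
def candidateProgram (s : ℕ) : Program :=
  .seq (assign 29 (.var 28 % (.lit 2 * .var 21))) <|
  .seq (assign 28 (.var 28 / (.lit 2 * .var 21))) <| .seq (assign 31 (.var 21 - .lit 1)) <|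
  .seq (forLoop 30 31 (storeAt (.var 24 + .var 30 + (.lit 1 - (.var 29 / .lit 2 - .var 30)))
    (.mem (.var 20 + .var 30)))) <|
  .seq (storeAt (.var 24 + .var 29 / .lit 2) (.var 29 % .lit 2)) (setDigitsProgram s)

theorem bitAt_insertIdx_skipIdx (y : List Bool) (d : ℕ) (b : Bool) (i : ℕ) :
    bitAt (y.insertIdx d b) (skipIdx d i) = bitAt y i := by
  simp only [bitAt, List.getD_eq_getElem?_getD, getElem?_insertIdx_skipIdx]

theorem bitAt_insertIdx_self {y : List Bool} {d : ℕ} (hd : d ≤ y.length) (b : Bool) :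
    bitAt (y.insertIdx d b) d = b.toNat := by
  simp only [bitAt, List.getD_eq_getElem?_getD, List.getElem?_insertIdx]
  simp [hd]

theorem runs_candidateProgram {B src scr s : ℕ} {y : List Bool} {a : State}
    (h20 : a.reg 20 = src) (h21 : a.reg 21 = y.length + 1) (h24 : a.reg 24 = scr)
    (h28 : a.reg 28 < B) (hscr : src + y.length ≤ scr) (hB : scr + 2 * (y.length + 1) + 2 < B)
    (hy : Holds a.mem src y) :
    Runs B (candidateProgram s) a (29 * (y.length + 1) + 30 * s + 50) fun b =>
      SameRegs 28 a b ∧ Holds b.mem scr (candidate s y (a.reg 28)) ∧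
        ∀ i < scr, b.mem i = a.mem i := by
  set m := 2 * (y.length + 1) with hm
  set e := a.reg 28 % m with he
  have he_lt : e < m := Nat.mod_lt _ (by omega)
  have hdiv : a.reg 28 / m ≤ a.reg 28 := Nat.div_le_self _ _
  have hd : e / 2 ≤ y.length := by omega
  have hlen := List.length_insertIdx_of_le_length (a := decide (e % 2 = 1)) hd
  refine Runs.mono_time (T := _) (Runs.assign_seq (by norm_num) ?_ <|
    Runs.assign_seq (by norm_num) ?_ <| Runs.assign_seq (by norm_num) ?_ <|
    Runs.seq <| (Runs.forLoop (T := 22) (N := y.length)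
      (I := fun i b => SameRegs 28 a b ∧ b.reg 28 = a.reg 28 / m ∧ b.reg 29 = e ∧
        b.reg 31 = y.length ∧ (∀ j < i, b.mem (scr + skipIdx (e / 2) j) = bitAt y j) ∧
        ∀ j < scr, b.mem j = a.mem j)
      (by norm_num) (by norm_num) (by omega) ?_ ?_ ?_).mono le_rfl ?_)
    (?_ : 9 + (9 + (6 + (y.length * (22 + 7) + 4 + (12 + (30 * s + 1))))) ≤ _)
  · simp [h21]; omega
  · simp [h21]; omega
  · simp [h21]; omega
  · exact fun i b hb => hb.2.2.2.1
  · rintro i hi b ⟨hb, hb28, hb29, hb31, hbmem, hblow⟩ hb30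
    have hb20 : b.reg 20 = src := (hb 20 (by norm_num)).trans h20
    have hb24 : b.reg 24 = scr := (hb 24 (by norm_num)).trans h24
    have hbit := bitAt_le_one y i
    have hread : b.mem (src + i) = bitAt y i := (hblow _ (by omega)).trans (hy i hi)
    -- Truncated subtraction replaces a test: `1 - (e / 2 - i)` is 1 from the insertion point on and
    -- 0 before it.
    have hskip : scr + i + (1 - (e / 2 - i)) = scr + skipIdx (e / 2) i := by
      unfold skipIdx; split_ifs <;> omega
    refine Runs.mono_time (Runs.storeAt ?_ ?_ ?_) ?_
    · simp [hb24, hb29, hb30]; omega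
    · simp [hb20, hb30, hread]; omega
    · refine ⟨by simp [hb30], hb.write.set (by norm_num), by simp [hb28], by simp [hb29],
        by simp [hb31], ?_, ?_⟩
      · intro j hj
        simp only [Expr.eval_add, Expr.eval_sub, Expr.eval_div, Expr.eval_var, Expr.eval_lit,
          Expr.eval_mem, State.mem_set, State.mem_write, hb20, hb24, hb29, hb30, hread, hskip]
        rcases Nat.lt_succ_iff_lt_or_eq.1 hj with hj | rfl
        · rw [if_neg, hbmem j hj]
          intro h
          have := skipIdx_injective _ (Nat.add_left_cancel h)
          omega
        · rw [if_pos rfl]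
      · intro j hj
        simp only [Expr.eval_add, Expr.eval_sub, Expr.eval_div, Expr.eval_var, Expr.eval_lit,
          State.mem_set, State.mem_write, hb24, hb29, hb30]
        rw [if_neg (by omega), hblow j hj]
    · simp
  · refine ⟨(((SameRegs.refl.set ?_).set ?_).set ?_).set ?_, ?_⟩ <;> simp [h21, ← hm, ← he]
  · rintro b ⟨⟨hb, hb28, hb29, hb31, hbmem, hblow⟩, -⟩
    have hb24 : b.reg 24 = scr := (hb 24 (by norm_num)).trans h24
    have hb21 : b.reg 21 = y.length + 1 := (hb 21 (by norm_num)).trans h21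
    refine Runs.storeAt_seq ?_ ?_ <| (runs_setDigitsProgram (scr := scr) s
      (x := y.insertIdx (e / 2) (decide (e % 2 = 1))) ?_ ?_ ?_ ?_ ?_ ?_).mono le_rfl ?_
    · simp [hb24, hb29]; omega
    · simp [hb29]; omega
    · rw [hlen]; exact hb21
    · exact hb24
    · rw [State.reg_write, hb28]; omega
    · omega
    · rw [hlen]; exact hB
    · intro i hi
      simp only [Expr.eval_add, Expr.eval_div, Expr.eval_mod, Expr.eval_var, Expr.eval_lit,
        State.mem_write, hb24, hb29]
      by_cases hi' : i = e / 2
      · rw [hi', if_pos rfl, bitAt_insertIdx_self hd, ← mod_two_eq_toNat]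
      · obtain ⟨j, hj, h1, h2⟩ := exists_skipIdx_eq hi'
        rw [if_neg (by omega), ← hj, bitAt_insertIdx_skipIdx, hbmem j (by omega)]
    · rintro c ⟨hc, hcx, hclow⟩
      refine ⟨hb.trans hc, ?_, ?_⟩
      · rw [hlen, State.reg_write, hb28] at hcx
        exact hcx
      · intro i hi
        rw [hclow i hi]
        simp only [Expr.eval_add, Expr.eval_div, Expr.eval_var, Expr.eval_lit, State.mem_write,
          hb24, hb29]
        rw [if_neg (by omega), hblow i hi]
  · omega

/-- Put the number `R[25]` into `R[27]` if the candidate with number `R[28]` has the given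
syndromes. -/
def checkProgram (s : ℕ) : Program :=
  .seq (candidateProgram s) <| .seq (fbProgram s (.var 24) (.var 21) (.var 24 + .var 21)) <|
  .seq (assign 32 (.lit 0)) <|
  .seq (forLoop 33 23 (assign 32 (.var 32 +
    ((.mem (.var 22 + .var 33) - .mem (.var 24 + .var 21 + .var 33)) +
      (.mem (.var 24 + .var 21 + .var 33) - .mem (.var 22 + .var 33)))))) <|
  .seq (assign 34 (.lit 1)) (.ifLt 32 34 (assign 27 (.var 25)) .skip)

/-- The time of `checkProgram`, per symbol. -/
def checkTime (s : ℕ) : ℕ := 29 + 300 * (2 * s + 1) ^ 2 + 45 * syndromeFactor s + 30 * s + 83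

-- The sum of the two truncated differences is the distance of two bits, so `R[32]` counts the
-- digits in which the syndromes differ and is 0 exactly when they agree.
open Classical in
theorem runs_checkProgram {B U src tgt scr s : ℕ} {y F : List Bool} {a : State}
    (h20 : a.reg 20 = src) (h21 : a.reg 21 = y.length + 1) (h22 : a.reg 22 = tgt)
    (h23 : a.reg 23 = F.length) (h24 : a.reg 24 = scr) (h25 : a.reg 25 < B) (h28 : a.reg 28 < B)
    (hF : F.length = syndromeLength s (y.length + 1)) (hscr : src + y.length ≤ scr)
    (htgt : tgt + F.length ≤ scr) (hU : scr + 2 * (y.length + 1) + F.length + 2 * s + 3 ≤ U)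
    (hB : U ^ (2 * s + 4) ≤ B) (hy : Holds a.mem src y) (hFm : Holds a.mem tgt F) :
    Runs B (checkProgram s) a (checkTime s * (y.length + 1)) fun b =>
      SameRegs 27 a b ∧
      b.reg 27 = (if Fb s (candidate s y (a.reg 28)) = F then a.reg 25 else a.reg 27) ∧
      ∀ i < scr, b.mem i = a.mem i := by
  have hUB : U ≤ B := (Nat.le_self_pow (by omega) U).trans hB
  set z := candidate s y (a.reg 28) with hz
  have hzlen : z.length = y.length + 1 := ((near_candidate s y _).1).symm
  have hlenF : (Fb s z).length = F.length := by rw [length_Fb, hzlen, hF]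
  refine Runs.mono_time (Runs.seq (U := y.length * (300 * (2 * s + 1) ^ 2) +
    300 * (2 * s + 1) ^ 2 + 18 + (3 + (F.length * 45 + 4 + 8))) <|
    (runs_candidateProgram (s := s) h20 h21 h24 h28 hscr (by omega) hy).mono le_rfl ?_) ?_
  · rintro b ⟨hb, hbz, hblow⟩
    rw [← hz] at hbz
    have hb21 := (hb 21 (by norm_num)).trans h21
    have hb24 := (hb 24 (by norm_num)).trans h24
    refine Runs.seq ((runs_fbProgram (U := U) (x := z) (p := scr + (y.length + 1)) ?_ ?_ ?_ ?_ ?_ ?_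
      ?_ ?_ ?_ hB).mono ?_ ?_)
    · simp [hb24]; omega
    · simp [hb21]; omega
    · simp [hb21, hb24]; omega
    · simp [hb21, hzlen]
    · simp [hb21, hb24]
    · simpa [hb24] using hbz
    · omega
    · simp [hb24, hzlen]
    · rw [hzlen, ← hF]; omega
    · simp [hzlen, add_mul]; omega
    rintro c ⟨hc, -, hcF, hclow⟩
    have hac : SameRegs 28 a c := hb.trans (hc.mono (by norm_num))
    have hclow' : ∀ i < scr, c.mem i = a.mem i := fun i hi =>
      (hclow i (by omega)).trans (hblow i hi)
    refine Runs.assign_seq (by norm_num) (show 0 < B by omega) ?_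
    refine Runs.seq ((Runs.forLoop (T := 38) (N := F.length)
      (I := fun i d => SameRegs 28 a d ∧ d.mem = c.mem ∧ d.reg 32 ≤ i ∧
        (d.reg 32 = 0 ↔ ∀ j < i, bitAt F j = bitAt (Fb s z) j))
      (by norm_num) (by norm_num) (by omega) ?_ ?_ ?_).mono le_rfl ?_)
    · exact fun i d hd => (hd.1 23 (by norm_num)).trans h23
    · rintro i hi d ⟨hd, hdmem, hd32, hdiff⟩ hd33
      have hd21 := (hd 21 (by norm_num)).trans h21
      have hd22 := (hd 22 (by norm_num)).trans h22
      have hd24 := (hd 24 (by norm_num)).trans h24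
      have e1 : c.mem (tgt + i) = bitAt F i := (hclow' _ (by omega)).trans (hFm i hi)
      have e2 : c.mem (scr + (y.length + 1) + i) = bitAt (Fb s z) i := hcF i (by omega)
      have hb1 := bitAt_le_one F i
      have hb2 := bitAt_le_one (Fb s z) i
      refine Runs.mono_time (Runs.assign (by norm_num) ?_ ?_) ?_
      · simp only [Expr.ok_add, Expr.ok_sub, Expr.ok_mem, Expr.ok_var, Expr.eval_add, Expr.eval_sub,
          Expr.eval_mem, Expr.eval_var, hd21, hd22, hd24, hd33, hdmem, e1, e2]
        omega
      · simp only [Expr.eval_add, Expr.eval_sub, Expr.eval_mem, Expr.eval_var, hd21, hd22, hd24,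
          hd33, hdmem, e1, e2]
        refine ⟨by simp [hd33], (hd.set (by norm_num)).set (by norm_num), by simp [hdmem], ?_, ?_⟩
        · simp only [State.reg_set, reduceIte, Nat.reduceEqDiff]
          omega
        · simp only [State.reg_set, reduceIte, Nat.reduceEqDiff]
          rw [Nat.add_eq_zero_iff, hdiff]
          constructor
          · rintro ⟨h1, h2⟩ j hj
            rcases Nat.lt_succ_iff_lt_or_eq.1 hj with hj | rfl
            · exact h1 j hj
            · omega
          · intro h
            have := h i (by omega)
            exact ⟨fun j hj => h j (by omega), by omega⟩
      · simp
    · refine ⟨(hac.set ?_).set ?_, ?_⟩ <;> simp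
    · rintro d ⟨⟨hd, hdmem, hd32, hdiff⟩, -⟩
      have hiff : d.reg 32 = 0 ↔ Fb s z = F := by
        rw [hdiff]
        exact ⟨fun h => (ext_bitAt hlenF.symm h).symm, fun h j _ => by rw [h]⟩
      have hd25 : d.reg 25 = a.reg 25 := hd 25 (by norm_num)
      have hd27 : d.reg 27 = a.reg 27 := hd 27 (by norm_num)
      refine Runs.mono_time (Runs.assign_seq (by norm_num) (show 1 < B by omega) <|
        Runs.ifLt (T := 4) (by norm_num) (by norm_num) ?_ ?_) (by simp)
      · intro hlt
        refine Runs.assign (by norm_num) ?_ ⟨?_, ?_, ?_⟩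
        · simp [hd25]; omega
        · exact ((hd.mono (by norm_num)).set (by norm_num)).set (by norm_num)
        · rw [if_pos (hiff.1 (by simpa using hlt))]
          simp [hd25]
        · intro i hi
          simp [hdmem, hclow' i hi]
      · intro hlt
        refine (Runs.skip ⟨?_, ?_, ?_⟩).mono_time (by norm_num)
        · exact (hd.mono (by norm_num)).set (by norm_num)
        · rw [if_neg (fun h => hlt (by simp [hiff.2 h]))]
          simp [hd27]
        · intro i hi
          simp [hdmem, hclow' i hi]
  · have h1 : F.length ≤ syndromeFactor s * (y.length + 1) :=
      hF ▸ syndromeLength_le s (Nat.succ_pos _)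
    unfold checkTime
    nlinarith [Nat.zero_le (s * y.length)]

/-- Search for the word with the given syndromes among the candidates. -/
def searchProgram (s : ℕ) : Program :=
  .seq (assign 26 ((Expr.lit 2 * .var 21).pow (s + 1))) <| .seq (assign 27 (.lit 0)) <|
  .seq (forLoop 25 26 (.seq (assign 28 (.var 25)) (checkProgram s))) <|
  .seq (assign 28 (.var 27)) (candidateProgram s)

/-- The coefficient in the time of `searchProgram`. -/
def searchTime (s : ℕ) : ℕ := 2 ^ (s + 1) * (checkTime s + 11) + 40 * s + 110

/-- `R[27]` keeps the number of the last candidate that passed the check, which is then written once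
more. Its initial value 0 is harmless: some candidate equals `x`, and all that pass equal `x`. -/
theorem runs_searchProgram {B U src tgt scr s : ℕ} {x y : List Bool} {a : State}
    (h20 : a.reg 20 = src) (h21 : a.reg 21 = x.length) (h22 : a.reg 22 = tgt)
    (h23 : a.reg 23 = (Fb s x).length) (h24 : a.reg 24 = scr) (hxy : Near s x y)
    (hscr : src + y.length ≤ scr) (htgt : tgt + (Fb s x).length ≤ scr)
    (hU : scr + 2 * x.length + syndromeLength s x.length + 2 * s + 3 ≤ U)
    (hB : U ^ (2 * s + 4) ≤ B) (hy : Holds a.mem src y) (hF : Holds a.mem tgt (Fb s x)) :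
    Runs B (searchProgram s) a (searchTime s * x.length ^ (s + 2)) fun b =>
      SameRegs 20 a b ∧ Holds b.mem scr x ∧ ∀ i < scr, b.mem i = a.mem i := by
  have hUB : U ≤ B := (Nat.le_self_pow (by omega) U).trans hB
  have hlen : y.length + 1 = x.length := hxy.1
  have hx0 : 0 < x.length := by omega
  have hlenF := length_Fb s x
  set tot := (2 * x.length) ^ (s + 1) with htot
  have htotB : tot < B := by
    calc tot ≤ U ^ (s + 1) := Nat.pow_le_pow_left (by omega) _
      _ < U ^ (2 * s + 4) := Nat.pow_lt_pow_right (by omega) (by omega)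
      _ ≤ B := hB
  refine Runs.mono_time (T := _) (Runs.assign_seq (by norm_num) ?_ <| Runs.assign_seq (by norm_num)
    (show 0 < B by omega) <|
    Runs.seq (U := 4 + (29 * x.length + 30 * s + 50)) <| (Runs.forLoop
      (T := 4 + checkTime s * x.length) (N := tot)
      (I := fun i b => SameRegs 25 a b ∧ b.reg 26 = tot ∧ b.reg 27 ≤ tot ∧
        (∀ j < scr, b.mem j = a.mem j) ∧
        ((∃ c < i, candidate s y c = x) → candidate s y (b.reg 27) = x))
      (by norm_num) (by norm_num) htotB ?_ ?_ ?_).mono le_rfl ?_)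
    ?_
  · refine Expr.Ok.pow (b := 2 * x.length) ?_ ?_ (by omega) htotB
    · simp [h21]; omega
    · simp [h21]
  · exact fun i b hb => hb.2.1
  · rintro i hi b ⟨hb, hb26, hb27, hblow, hbest⟩ hb25
    refine Runs.assign_seq (by norm_num) ⟨by norm_num, by omega⟩ ?_
    rw [Expr.eval_var, hb25, ← hlen]
    have hs : SameRegs 25 a (b.set 28 i) := hb.set (by norm_num)
    refine (runs_checkProgram (U := U) (y := y) (F := Fb s x) (src := src) (tgt := tgt)
      (scr := scr) ?_ ?_ ?_ ?_ ?_ ?_ ?_ ?_ hscr htgt ?_ hB ?_ ?_).mono le_rfl ?_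
    · rw [hs 20 (by norm_num), h20]
    · rw [hs 21 (by norm_num), h21, hlen]
    · rw [hs 22 (by norm_num), h22]
    · rw [hs 23 (by norm_num), h23]
    · rw [hs 24 (by norm_num), h24]
    · simp [hb25]; omega
    · simp; omega
    · rw [hlen, hlenF]
    · omega
    · exact hy.congr fun j hj => hblow _ (by omega)
    · exact hF.congr fun j hj => hblow _ (by omega)
    rintro c ⟨hc, hc27, hclow⟩
    have h28 : (b.set 28 i).reg 28 = i := by simp
    have h25' : (b.set 28 i).reg 25 = i := by simp [hb25]
    have h27' : (b.set 28 i).reg 27 = b.reg 27 := by simp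
    rw [h28, h25', h27'] at hc27
    refine ⟨(hc 25 (by norm_num)).trans h25', ?_, ?_, ?_, ?_, ?_⟩
    · exact (hs.trans (hc.mono (by norm_num))).set le_rfl
    · simp [hc 26 (by norm_num), hb26]
    · simp only [State.reg_set, reduceIte, Nat.reduceEqDiff, hc27]
      split_ifs <;> omega
    · intro j hj
      rw [State.mem_set, hclow j hj, State.mem_set, hblow j hj]
    · rintro ⟨k, hk, hkx⟩
      simp only [State.reg_set, reduceIte, Nat.reduceEqDiff, hc27]
      split_ifs with h
      · exact (near_candidate s y i).unique hxy h
      · refine hbest ⟨k, ?_, hkx⟩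
        rcases Nat.lt_succ_iff_lt_or_eq.1 hk with hk | rfl
        · exact hk
        · exact absurd (by rw [hkx]) h
  · refine ⟨((SameRegs.refl.set ?_).set ?_).set ?_, ?_⟩ <;> simp [h21, htot]
  · rintro b ⟨⟨hb, hb26, hb27, hblow, hbest⟩, -⟩
    refine Runs.assign_seq (by norm_num) ⟨by norm_num, by omega⟩ ?_
    have hs : SameRegs 25 a (b.set 28 (b.reg 27)) := hb.set (by norm_num)
    rw [← hlen]
    refine (runs_candidateProgram (y := y) (src := src) (scr := scr) ?_ ?_ ?_ ?_ hscr ?_ ?_).mono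
      le_rfl ?_
    · exact (hs 20 (by norm_num)).trans h20
    · exact ((hs 21 (by norm_num)).trans h21).trans hlen.symm
    · exact (hs 24 (by norm_num)).trans h24
    · simp; omega
    · omega
    · exact hy.congr fun j hj => hblow _ (by omega)
    rintro c ⟨hc, hcx, hclow⟩
    refine ⟨(hs.mono (by norm_num)).trans (hc.mono (by norm_num)), ?_, ?_⟩
    · rw [Expr.eval_var, State.reg_set, if_pos rfl, hbest hxy.exists_candidate_eq] at hcx
      exact hcx
    · intro i hi
      rw [hclow i hi, State.mem_set, hblow i hi]
  -- There are `(2 |x|) ^ (s + 1)` candidates, each checked in time linear in `|x|`.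
  · have h1 : tot * x.length = 2 ^ (s + 1) * x.length ^ (s + 2) := by
      rw [htot, mul_pow]; ring
    have h2 : tot ≤ tot * x.length := Nat.le_mul_of_pos_right _ hx0
    have h3 : x.length ≤ x.length ^ (s + 2) := Nat.le_self_pow (by omega) _
    have h4 : tot * (4 + checkTime s * x.length + 7) ≤
        (checkTime s + 11) * (2 ^ (s + 1) * x.length ^ (s + 2)) := by
      rw [← h1]; nlinarith
    simp only [Expr.cost_pow, Expr.cost_mul, Expr.cost_lit, Expr.cost_var]
    unfold searchTime
    nlinarith

/-! ### The decoding program -/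

theorem bitAt_take {y : List Bool} {k i : ℕ} (h : i < k) : bitAt (y.take k) i = bitAt y i := by
  simp [bitAt, List.getD_eq_getElem?_getD, h]

theorem bitAt_drop (y : List Bool) (k i : ℕ) : bitAt (y.drop k) i = bitAt y (k + i) := by
  simp [bitAt, List.getD_eq_getElem?_getD]

theorem Holds.take {mem : ℕ → ℕ} {p : ℕ} {y : List Bool} (h : Holds mem p y) (k : ℕ) :
    Holds mem p (y.take k) := by
  intro i hi
  rw [List.length_take] at hi
  rw [bitAt_take (by omega), h i (by omega)]

theorem Holds.drop {mem : ℕ → ℕ} {p : ℕ} {y : List Bool} (h : Holds mem p y) (k : ℕ) :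
    Holds mem (p + k) (y.drop k) := by
  intro i hi
  rw [List.length_drop] at hi
  rw [bitAt_drop, add_assoc, h (k + i) (by omega)]

open Finset in
/-- Decoding of the repetition code by majority. -/
theorem majority_eq {s : ℕ} {z y : List Bool} (h : Near s (repetition (2 * s + 2) z) y) {j : ℕ}
    (hj : j < z.length) :
    (∑ t ∈ range (2 * s + 1), bitAt y ((2 * s + 2) * j + t)) / (s + 1) = bitAt z j := by
  have hlen := h.1
  rw [length_repetition] at hlen
  have hle : (2 * s + 2) * (j + 1) ≤ (2 * s + 2) * z.length := Nat.mul_le_mul_left _ hj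
  rw [mul_add] at hle
  have hmis := h.repetition_block hj
  have hiff (t : ℕ) (ht : t ∈ range (2 * s + 1)) :
      bitAt y ((2 * s + 2) * j + t) = bitAt z j ↔ y[(2 * s + 2) * j + t]? = z[j]? :=
    bitAt_eq_iff (by rw [mem_range] at ht; omega) hj
  have h1 : ∑ t ∈ range (2 * s + 1), bitAt y ((2 * s + 2) * j + t) ≤
      ∑ t ∈ range (2 * s + 1), (bitAt z j + if y[(2 * s + 2) * j + t]? ≠ z[j]? then 1 else 0) := by
    refine sum_le_sum fun t ht => ?_
    have := bitAt_le_one y ((2 * s + 2) * j + t)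
    split_ifs with h
    · omega
    · rw [(hiff t ht).2 (not_not.1 h)]; omega
  have h2 : ∑ t ∈ range (2 * s + 1), bitAt z j ≤ ∑ t ∈ range (2 * s + 1),
      (bitAt y ((2 * s + 2) * j + t) + if y[(2 * s + 2) * j + t]? ≠ z[j]? then 1 else 0) := by
    refine sum_le_sum fun t ht => ?_
    have := bitAt_le_one z j
    split_ifs with h
    · omega
    · rw [(hiff t ht).2 (not_not.1 h)]; omega
  rw [sum_add_distrib, sum_boole] at h1 h2
  simp only [sum_const, card_range, smul_eq_mul, Nat.cast_id] at h1 h2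
  have hz := bitAt_le_one z j
  -- At most `s` symbols are wrong, so the sum is at most `s` for the bit 0 and between `s + 1` and
  -- `2 s + 1` for the bit 1. Division by `s + 1` is therefore the majority vote.
  interval_cases hb : bitAt z j
  · rw [Nat.div_eq_of_lt (by omega)]
  · have h3 : ∑ t ∈ range (2 * s + 1), bitAt y ((2 * s + 2) * j + t) ≤ 2 * s + 1 := by
      simpa using sum_le_card_nsmul (range (2 * s + 1)) _ 1 fun t _ => bitAt_le_one y _
    rw [Nat.div_eq_of_lt_le] <;> omega

/-- Decode `R[3]` blocks of the repetition code, from the address `R[4]` on. The result is written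
from the address `R[0]` on. -/
def majorityProgram (s : ℕ) : Program :=
  forLoop 5 3 <|
    .seq (assign 6 (.lit 0)) <| .seq (assign 7 (.lit (2 * s + 1))) <|
    .seq (forLoop 8 7
      (assign 6 (.var 6 + .mem (.var 4 + .lit (2 * s + 2) * .var 5 + .var 8)))) <|
    storeAt (.var 0 + .var 5) (.var 6 / .lit (s + 1))

open Finset in
theorem runs_majorityProgram {B N p s : ℕ} {z y : List Bool} {a : State} (h0 : a.reg 0 = N)
    (h3 : a.reg 3 = z.length) (h4 : a.reg 4 = p) (h : Near s (repetition (2 * s + 2) z) y)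
    (hp : p + y.length ≤ N) (hB : N + z.length + 2 * s + 3 ≤ B)
    (hy : Holds a.mem p y) :
    Runs B (majorityProgram s) a (z.length * (46 * s + 50) + 4) fun b =>
      SameRegs 5 a b ∧ Holds b.mem N z ∧ ∀ i < N, b.mem i = a.mem i := by
  have hlen := h.1
  rw [length_repetition] at hlen
  refine Runs.mono_time ((Runs.forLoop (T := (2 * s + 1) * 23 + 20) (N := z.length)
    (I := fun i b => SameRegs 5 a b ∧ (∀ j < i, b.mem (N + j) = bitAt z j) ∧
      ∀ i < N, b.mem i = a.mem i)
    (by norm_num) (by norm_num) (by omega) ?_ ?_ ?_).mono le_rfl ?_) (le_of_eq (by ring))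
  · exact fun i b hb => (hb.1 3 (by norm_num)).trans h3
  · rintro i hi b ⟨hb, hbz, hblow⟩ hb5
    have hle : (2 * s + 2) * (i + 1) ≤ (2 * s + 2) * z.length := Nat.mul_le_mul_left _ hi
    rw [mul_add] at hle
    have hii : i ≤ (2 * s + 2) * i := Nat.le_mul_of_pos_left _ (by omega)
    have hb0 : b.reg 0 = N := (hb 0 (by norm_num)).trans h0
    have hb4 : b.reg 4 = p := (hb 4 (by norm_num)).trans h4
    have hacc (k : ℕ) : ∑ t ∈ range k, bitAt y ((2 * s + 2) * i + t) ≤ k := by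
      simpa using sum_le_card_nsmul (range k) _ 1 fun t _ => bitAt_le_one y _
    refine Runs.mono_time (Runs.assign_seq (by norm_num) (show 0 < B by omega) <|
      Runs.assign_seq (by norm_num) (show 2 * s + 1 < B by omega) <|
      Runs.seq (U := 10) <| (Runs.forLoop (T := 16) (N := 2 * s + 1)
        (I := fun k c => SameRegs 6 b c ∧ c.mem = b.mem ∧ c.reg 7 = 2 * s + 1 ∧
          c.reg 6 = ∑ t ∈ range k, bitAt y ((2 * s + 2) * i + t))
        (by norm_num) (by norm_num) (by omega) ?_ ?_ ?_).mono le_rfl ?_) ?_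
    · exact fun k c hc => hc.2.2.1
    · rintro k hk c ⟨hc, hcmem, hc7, hc6⟩ hc8
      have hc4 : c.reg 4 = p := (hc 4 (by norm_num)).trans hb4
      have hc5 : c.reg 5 = i := (hc 5 (by norm_num)).trans hb5
      have h1 := hacc k
      have h2 := hacc (k + 1)
      have hread : c.mem (p + (2 * s + 2) * i + k) = bitAt y ((2 * s + 2) * i + k) := by
        rw [hcmem, add_assoc, hblow _ (by omega), hy _ (by omega)]
      rw [sum_range_succ, ← hread] at h2
      refine Runs.mono_time (Runs.assign (by norm_num) ?_ ?_) ?_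
      · simp only [Expr.ok_add, Expr.ok_mul, Expr.ok_mem, Expr.ok_var, Expr.ok_lit, Expr.eval_add,
          Expr.eval_mul, Expr.eval_mem, Expr.eval_var, Expr.eval_lit, hc4, hc5, hc8, hc6]
        omega
      · refine ⟨by simp [hc8], (hc.set (by norm_num)).set (by norm_num), by simp [hcmem],
          by simp [hc7], ?_⟩
        rw [sum_range_succ, ← hread]
        simp [hc4, hc5, hc8, hc6]
      · simp
    · refine ⟨((SameRegs.refl.set ?_).set ?_).set ?_, ?_⟩ <;> simp
    · rintro c ⟨⟨hc, hcmem, -, hc6⟩, -⟩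
      have hc0 : c.reg 0 = N := (hc 0 (by norm_num)).trans hb0
      have hc5 : c.reg 5 = i := (hc 5 (by norm_num)).trans hb5
      have h1 := hacc (2 * s + 1)
      refine Runs.mono_time (Runs.storeAt ?_ ?_ ⟨?_, ?_, ?_, ?_⟩) ?_
      · simp [hc0, hc5]; omega
      · simp [hc6]; omega
      · simp [hc5]
      · exact ((hb.trans (hc.mono (by norm_num))).write).set (by norm_num)
      · intro j hj
        simp only [Expr.eval_add, Expr.eval_div, Expr.eval_var, Expr.eval_lit, State.mem_set,
          State.mem_write, hc0, hc5, hc6, hcmem]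
        rcases Nat.lt_succ_iff_lt_or_eq.1 hj with hj | rfl
        · rw [if_neg (by omega), hbz j hj]
        · rw [if_pos rfl, majority_eq h hi]
      · intro j hj
        simp only [Expr.eval_add, Expr.eval_var, State.mem_set, State.mem_write, hc0, hc5, hcmem]
        rw [if_neg (by omega), hblow j hj]
      · simp
    · simp; omega
  · exact ⟨SameRegs.refl.set (by norm_num), fun j hj => absurd hj (Nat.not_lt_zero j),
      fun _ _ => rfl⟩
  · rintro b ⟨⟨hb, hbz, hblow⟩, -⟩
    exact ⟨hb, hbz, hblow⟩

/-- Call `searchProgram`. -/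
def callSearch (s : ℕ) (src len tgt tlen scr : Expr) : Program :=
  .seq (assign 20 src) <| .seq (assign 21 len) <| .seq (assign 22 tgt) <|
    .seq (assign 23 tlen) <| .seq (assign 24 scr) (searchProgram s)

/-- The arguments are read while `R[20], …, R[24]` are being filled, so they are required to have
the same value in every state that agrees below `R[20]`. -/
theorem runs_callSearch {B U p q r s : ℕ} {x y : List Bool} {a : State}
    {src len tgt tlen scr : Expr}
    (hsrc : ∀ b, SameRegs 20 a b → src.Ok B b ∧ src.eval b = p)
    (hlen : ∀ b, SameRegs 20 a b → len.Ok B b ∧ len.eval b = x.length)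
    (htgt : ∀ b, SameRegs 20 a b → tgt.Ok B b ∧ tgt.eval b = q)
    (htlen : ∀ b, SameRegs 20 a b → tlen.Ok B b ∧ tlen.eval b = (Fb s x).length)
    (hscr : ∀ b, SameRegs 20 a b → scr.Ok B b ∧ scr.eval b = r) (hxy : Near s x y)
    (hp : p + y.length ≤ r) (hq : q + (Fb s x).length ≤ r)
    (hU : r + 2 * x.length + syndromeLength s x.length + 2 * s + 3 ≤ U)
    (hB : U ^ (2 * s + 4) ≤ B) (hy : Holds a.mem p y) (hF : Holds a.mem q (Fb s x)) :
    Runs B (callSearch s src len tgt tlen scr) a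
      (src.cost + len.cost + tgt.cost + tlen.cost + scr.cost + 10 +
        searchTime s * x.length ^ (s + 2)) fun b =>
      SameRegs 20 a b ∧ Holds b.mem r x ∧ ∀ i < r, b.mem i = a.mem i := by
  have h0 : SameRegs 20 a a := SameRegs.refl
  have h1 := h0.set (v := 20) (x := src.eval a) le_rfl
  have h2 := h1.set (v := 21) (x := x.length) (by norm_num)
  have h3 := h2.set (v := 22) (x := q) (by norm_num)
  have h4 := h3.set (v := 23) (x := (Fb s x).length) (by norm_num)
  have h5 := h4.set (v := 24) (x := r) (by norm_num)
  refine Runs.mono_time (Runs.assign_seq (T := len.cost + 2 + (tgt.cost + 2 + (tlen.cost + 2 +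
    (scr.cost + 2 + searchTime s * x.length ^ (s + 2))))) (by norm_num) (hsrc a h0).1 ?_) (by omega)
  refine Runs.assign_seq (by norm_num) (hlen _ h1).1 ?_
  rw [(hlen _ h1).2]
  refine Runs.assign_seq (by norm_num) (htgt _ h2).1 ?_
  rw [(htgt _ h2).2]
  refine Runs.assign_seq (by norm_num) (htlen _ h3).1 ?_
  rw [(htlen _ h3).2]
  refine Runs.assign_seq (by norm_num) (hscr _ h4).1 ?_
  rw [(hscr _ h4).2]
  rw [(hsrc a h0).2] at h5 ⊢
  refine (runs_searchProgram (x := x) (y := y) (src := p) (tgt := q) (scr := r) ?_ ?_ ?_ ?_ ?_ hxy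
    hp hq hU hB ?_ ?_).mono le_rfl ?_
  · simp
  · simp
  · simp
  · simp
  · simp
  · exact hy
  · exact hF
  · exact fun b hb => ⟨h5.trans hb.1, hb.2⟩

/-- Move the word of length `R[1]` at the address `src` to the address `0` and return it. -/
def returnProgram (src : Expr) : Program :=
  .seq (forLoop 5 1 (storeAt (.var 5) (.mem (src + .var 5)))) (assign 0 (.var 1))

theorem runs_returnProgram {B p : ℕ} {x : List Bool} {a : State} {src : Expr}
    (hsrc : ∀ b, SameRegs 5 a b → src.Ok B b ∧ src.eval b = p) (h1 : a.reg 1 = x.length)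
    (hp : x.length ≤ p) (hB : p + x.length + 2 ≤ B) (hx : Holds a.mem p x) :
    Runs B (returnProgram src) a (x.length * (src.cost + 14) + 8) fun b => b.HasOutput x := by
  refine Runs.mono_time (Runs.seq (U := 4) <| (Runs.forLoop (T := src.cost + 7) (N := x.length)
    (I := fun i b => SameRegs 5 a b ∧ (∀ j < i, b.mem j = bitAt x j) ∧ Holds b.mem p x)
    (by norm_num) (by norm_num) (by omega) ?_ ?_ ?_).mono le_rfl ?_) (le_of_eq (by ring))
  · exact fun i b hb => (hb.1 1 (by norm_num)).trans h1
  · rintro i hi b ⟨hb, hbx, hbp⟩ hb5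
    obtain ⟨hok, heval⟩ := hsrc b hb
    have hbit := bitAt_le_one x i
    have hread := hbp i hi
    refine Runs.mono_time (Runs.storeAt ?_ ?_ ⟨?_, ?_, ?_, ?_⟩) ?_
    · simp [hb5]; omega
    · simp [hok, heval, hb5, hread]; omega
    · simp [hb5]
    · exact hb.write.set le_rfl
    · intro j hj
      simp only [Expr.eval_add, Expr.eval_var, Expr.eval_mem, State.mem_set, State.mem_write, heval,
        hb5, hread]
      rcases Nat.lt_succ_iff_lt_or_eq.1 hj with hj | rfl
      · rw [if_neg (by omega), hbx j hj]
      · rw [if_pos rfl]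
    · refine hbp.congr fun j hj => ?_
      simp only [Expr.eval_var, State.mem_set, State.mem_write, hb5]
      rw [if_neg (by omega)]
    · simp; omega
  · exact ⟨SameRegs.refl.set le_rfl, fun j hj => absurd hj (Nat.not_lt_zero j), hx⟩
  · rintro b ⟨⟨hb, hbx, -⟩, -⟩
    have hb1 : b.reg 1 = x.length := (hb 1 (by norm_num)).trans h1
    refine Runs.assign (by norm_num) ?_ (hasOutput_of_holds (by simp [hb1]) ?_)
    · simp [hb1]; omega
    · intro i hi
      rw [State.mem_set, zero_add]
      exact hbx i hi

/-- The decoder after the syndromes of the syndromes `Fb s x` have been found: `R[2]` and `R[3]` are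
the numbers of bits of `Fb s x` and `Fb s (Fb s x)`. -/
def decodeRest (s : ℕ) : Program :=
  .seq (callSearch s (.var 1) (.var 2) (.var 0) (.var 3) (.var 0 + .var 3)) <|
  .seq (callSearch s (.lit 0) (.var 1) (.var 0 + .var 3) (.var 2) (.var 0 + .var 3 + .var 2)) <|
  returnProgram (.var 0 + .var 3 + .var 2)

/-- The word found by the first search is the target of the second. The words `Fb s (Fb s x)`, `Fb s
x` and `x` are stacked behind the received word, and each search only changes the memory from its
own result on. -/
theorem runs_decodeRest {B U N m M s : ℕ} {x y : List Bool} {a : State} (h0 : a.reg 0 = N)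
    (h1 : a.reg 1 = x.length) (h2 : a.reg 2 = m) (h3 : a.reg 3 = M) (hlenF : (Fb s x).length = m)
    (hlenFF : (Fb s (Fb s x)).length = M) (hN : y.length = N) (hNx : x.length + m ≤ N + 1)
    (hyx : Near s x (y.take (x.length - 1)))
    (hyF : Near s (Fb s x) ((y.drop x.length).take (m - 1)))
    (hU : N + 2 * x.length + 2 * m + 2 * M + 2 * s + 3 ≤ U) (hB : U ^ (2 * s + 4) ≤ B)
    (hy : Holds a.mem 0 y) (hF : Holds a.mem N (Fb s (Fb s x))) :
    Runs B (decodeRest s) a (searchTime s * m ^ (s + 2) + 23 + (searchTime s * x.length ^ (s + 2) +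
      29 + (x.length * 22 + 8))) fun b => b.HasOutput x := by
  have hUB : U ≤ B := (Nat.le_self_pow (by omega) U).trans hB
  have hm : syndromeLength s x.length = m := by rw [← length_Fb, hlenF]
  have hM : syndromeLength s m = M := by rw [← hlenF, ← length_Fb, hlenFF]
  have hlen1 : (y.take (x.length - 1)).length + 1 = x.length := hyx.1
  have hlen2 : ((y.drop x.length).take (m - 1)).length + 1 = m := hyF.1.trans hlenF
  refine Runs.seq ((runs_callSearch (U := U) (p := x.length) (q := N) (r := N + M) (x := Fb s x)
    (y := (y.drop x.length).take (m - 1)) ?_ ?_ ?_ ?_ ?_ hyF ?_ ?_ ?_ hB ?_ hF).mono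
    (by simp [hlenF]; omega) ?_)
  · intro e he
    simp [(he 1 (by norm_num)).trans h1]; omega
  · intro e he
    simp [(he 2 (by norm_num)).trans h2, hlenF]; omega
  · intro e he
    simp [(he 0 (by norm_num)).trans h0]; omega
  · intro e he
    simp [(he 3 (by norm_num)).trans h3, hlenFF]; omega
  · intro e he
    simp [(he 0 (by norm_num)).trans h0, (he 3 (by norm_num)).trans h3]; omega
  · omega
  · rw [hlenFF]
  · rw [hlenF]; omega
  · simpa using (hy.drop x.length).take (m - 1)
  rintro e ⟨he, heF, helow⟩
  have he0 : e.reg 0 = N := (he 0 (by norm_num)).trans h0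
  have he1 : e.reg 1 = x.length := (he 1 (by norm_num)).trans h1
  have he2 : e.reg 2 = m := (he 2 (by norm_num)).trans h2
  have he3 : e.reg 3 = M := (he 3 (by norm_num)).trans h3
  have hey : Holds e.mem 0 y := hy.congr fun i hi => helow _ (by omega)
  refine Runs.seq ((runs_callSearch (U := U) (p := 0) (q := N + M) (r := N + M + m) (x := x)
    (y := y.take (x.length - 1)) ?_ ?_ ?_ ?_ ?_ hyx ?_ ?_ ?_ hB (hey.take _) heF).mono
    (by simp; omega) ?_)
  · intro f hf
    simp; omega
  · intro f hf
    simp [(hf 1 (by norm_num)).trans he1]; omega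
  · intro f hf
    simp [(hf 0 (by norm_num)).trans he0, (hf 3 (by norm_num)).trans he3]; omega
  · intro f hf
    simp [(hf 2 (by norm_num)).trans he2, hlenF]; omega
  · intro f hf
    simp [(hf 0 (by norm_num)).trans he0, (hf 2 (by norm_num)).trans he2,
      (hf 3 (by norm_num)).trans he3]
    omega
  · omega
  · rw [hlenF]
  · omega
  rintro f ⟨hf, hfx, -⟩
  have hf0 : f.reg 0 = N := (hf 0 (by norm_num)).trans he0
  have hf1 : f.reg 1 = x.length := (hf 1 (by norm_num)).trans he1
  have hf2 : f.reg 2 = m := (hf 2 (by norm_num)).trans he2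
  have hf3 : f.reg 3 = M := (hf 3 (by norm_num)).trans he3
  refine (runs_returnProgram (p := N + M + m) ?_ hf1 ?_ ?_ hfx).mono_time (by simp)
  · intro g hg
    simp [(hg 0 (by norm_num)).trans hf0, (hg 2 (by norm_num)).trans hf2,
      (hg 3 (by norm_num)).trans hf3]
    omega
  · omega
  · omega

/-- The decoder: `R[2]` and `R[3]` are the numbers of bits of the syndromes `Fb s x` and
`Fb s (Fb s x)`. -/
def decodeProgram (s : ℕ) : Program :=
  .seq (fbProgram s (.lit 0) (.var 1) (.var 0)) <| .seq (assign 2 (.var 43)) <|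
  .seq (fbProgram s (.lit 0) (.var 2) (.var 0)) <| .seq (assign 3 (.var 43)) <|
  .seq (assign 4 (.var 1 + .var 2)) <| .seq (majorityProgram s)
    (decodeRest s)

/-- The numbers of syndrome bits depend on lengths only, so they are found by computing the
syndromes of prefixes of `y` of lengths `n` and `m`, whose contents are irrelevant. The output goes
past the end of `y` and is discarded. -/
theorem runs_decodeProgram {B U s : ℕ} {x y : List Bool} (hx0 : 0 < x.length)
    (h : Near s (encode s x) y)
    (hU : codeLength s x.length + 2 * x.length + 2 * syndromeLength s x.length +
      2 * syndromeLength s (syndromeLength s x.length) + 2 * s + 3 ≤ U)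
    (hB : U ^ (2 * s + 4) ≤ B) :
    Runs B (decodeProgram s) (init x.length y)
      (x.length * (300 * (2 * s + 1) ^ 2) + syndromeLength s x.length * (300 * (2 * s + 1) ^ 2) +
        syndromeLength s (syndromeLength s x.length) * (46 * s + 50) +
        searchTime s * syndromeLength s x.length ^ (s + 2) + searchTime s * x.length ^ (s + 2) +
        x.length * 22 + 110)
      fun b => b.HasOutput x := by
  have hUB : U ≤ B := (Nat.le_self_pow (by omega) U).trans hB
  obtain ⟨h1, h2, h3⟩ := h.parts hx0
  have hylen := h.1
  rw [length_encode] at hylen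
  set n := x.length with hn
  set m := syndromeLength s n with hm
  set m' := syndromeLength s m with hm'
  set N := y.length with hN
  have hm0 : 0 < m := syndromeLength_pos s hx0
  have hm0' : 0 < m' := syndromeLength_pos s hm0
  have hlenF : (Fb s x).length = m := length_Fb s x
  have hlenFF : (Fb s (Fb s x)).length = m' := by rw [length_Fb, hlenF]
  have hmm' : m' ≤ (2 * s + 2) * m' := Nat.le_mul_of_pos_left _ (by omega)
  rw [codeLength, ← hm, ← hm'] at hU hylen
  obtain ⟨R, hR⟩ : ∃ R, (2 * s + 2) * m' = R := ⟨_, rfl⟩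
  rw [hR] at hU hylen hmm'
  have i0 : (init n y).reg 0 = N := rfl
  have i1 : (init n y).reg 1 = n := rfl
  have hy := holds_init n y
  have htake : (y.take n).length = n := by simp; omega
  have htake' : (y.take m).length = m := by simp; omega
  have hlen1 : (y.take (n - 1)).length + 1 = n := h1.1
  have hlen2 : ((y.drop n).take (m - 1)).length + 1 = m := h2.1.trans hlenF
  refine Runs.mono_time (Runs.seq (U := 4 + (m * (300 * (2 * s + 1) ^ 2) + 14 + (4 + (7 +
    ((m' * (46 * s + 50) + 4) + ((searchTime s * m ^ (s + 2) + 23) +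
      ((searchTime s * n ^ (s + 2) + 29) + (n * 22 + 8)))))))) <|
    (runs_fbProgram (U := U) (x := y.take n) (p := N) (src := .lit 0) (by simp; omega) ?_ ?_ ?_ ?_
      (hy.take n) (by omega) ?_ ?_ hB).mono le_rfl ?_) ?_
  · simp [i1]; omega
  · simp [i0]; omega
  · simp [i1]; omega
  · simp [i0]
  · simp; omega
  · rw [htake, ← hm]; omega
  · rintro b ⟨hb, hb43, -, hblow⟩
    rw [htake, ← hm] at hb43
    have hb0 : b.reg 0 = N := hb 0 (by norm_num)
    have hb1 : b.reg 1 = n := hb 1 (by norm_num)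
    have hby : Holds b.mem 0 y := hy.congr fun i hi => hblow _ (by omega)
    refine Runs.assign_seq (by norm_num) ⟨by norm_num, by omega⟩ ?_
    rw [Expr.eval_var, hb43]
    refine Runs.seq ((runs_fbProgram (U := U) (x := y.take m) (p := N) (src := .lit 0)
      (a := b.set 2 m) (len := .var 2) (dst := .var 0) (by simp; omega) ?_ ?_ ?_ ?_ (hby.take m)
      (by omega) ?_ ?_ hB).mono
      (by simp [htake']; omega) ?_)
    · simp; omega
    · simp [hb0]; omega
    · simp; omega
    · simp [hb0]
    · simp; omega
    · rw [htake', ← hm']; omega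
    rintro c ⟨hc, hc43, -, hclow⟩
    rw [htake', ← hm'] at hc43
    have hc0 : c.reg 0 = N := by rw [hc 0 (by norm_num)]; simp [hb0]
    have hc1 : c.reg 1 = n := by rw [hc 1 (by norm_num)]; simp [hb1]
    have hc2 : c.reg 2 = m := by rw [hc 2 (by norm_num)]; simp
    have hcy : Holds c.mem 0 y := hby.congr fun i hi => hclow _ (by omega)
    refine Runs.assign_seq (by norm_num) ⟨by norm_num, by omega⟩ ?_
    rw [Expr.eval_var, hc43]
    refine Runs.assign_seq (by norm_num) ?_ ?_
    · simp [hc1, hc2]; omega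
    have e4 : (Expr.var 1 + .var 2).eval (c.set 3 m') = n + m := by simp [hc1, hc2]
    rw [e4]
    refine Runs.seq ((runs_majorityProgram (N := N) (p := n + m) (z := Fb s (Fb s x))
      (y := y.drop (n + m)) ?_ ?_ ?_ h3 ?_ ?_ ?_).mono (by rw [hlenFF]) ?_)
    · simp [hc0]
    · simp [hlenFF]
    · simp
    · simp; omega
    · rw [hlenFF]; omega
    · simpa using hcy.drop (n + m)
    rintro d ⟨hd, hdFF, hdlow⟩
    have hd0 : d.reg 0 = N := by rw [hd 0 (by norm_num)]; simp [hc0]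
    have hd1 : d.reg 1 = n := by rw [hd 1 (by norm_num)]; simp [hc1]
    have hd2 : d.reg 2 = m := by rw [hd 2 (by norm_num)]; simp [hc2]
    have hd3 : d.reg 3 = m' := by rw [hd 3 (by norm_num)]; simp
    have hdy : Holds d.mem 0 y := hcy.congr fun i hi => hdlow _ (by omega)
    exact runs_decodeRest (U := U) hd0 hd1 hd2 hd3 hlenF hlenFF rfl (by omega) h1 h2 (by omega) hB
      hdy hdFF
  · simp [htake]; omega

theorem exists_decodeProgram (s : ℕ) : ∃ (p : Program) (a K : ℕ), ∀ n : ℕ, 1 ≤ n →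
    ∀ x : List Bool, x.length = n → ∀ y ∈ ball 1 s (encode s x),
      RunsIn p (a * (Nat.log 2 n + 1)) n y x (K * n ^ (s + 2)) := by
  set c := 1 + syndromeFactor s + (2 * s + 3) * syndromeFactor s ^ 2 + 2 * s + 3 with hc
  obtain ⟨a, ha⟩ := exists_word_length (3 * c) (2 * s + 4)
  refine ⟨decodeProgram s, a, 300 * (2 * s + 1) ^ 2 + c * (300 * (2 * s + 1) ^ 2) +
    c * (46 * s + 50) + searchTime s * syndromeFactor s ^ (s + 2) + searchTime s + 132, ?_⟩
  rintro n hn x rfl y hy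
  have hnear := near_of_mem_ball hy
  have hlen := hnear.1
  rw [length_encode] at hlen
  have hU := codeLength_le s hn
  rw [← hc] at hU
  have h1 : syndromeLength s x.length ≤ syndromeFactor s * x.length := syndromeLength_le s hn
  have hN : codeLength s x.length = x.length + syndromeLength s x.length +
    (2 * s + 2) * syndromeLength s (syndromeLength s x.length) := rfl
  have hmm' : syndromeLength s (syndromeLength s x.length) ≤
      (2 * s + 2) * syndromeLength s (syndromeLength s x.length) :=
    Nat.le_mul_of_pos_left _ (by omega)
  have hU' : codeLength s x.length + 2 * x.length + 2 * syndromeLength s x.length +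
      2 * syndromeLength s (syndromeLength s x.length) + 2 * s + 3 ≤ 3 * c * x.length := by
    rw [mul_assoc]; omega
  have hUB : 3 * c * x.length ≤ (3 * c * x.length) ^ (2 * s + 4) := Nat.le_self_pow (by omega) _
  refine Runs.runsIn ((runs_decodeProgram hn hnear hU' le_rfl).mono_time ?_) (ha _) (by omega)
    (by omega)
  have h2 : syndromeLength s x.length * (300 * (2 * s + 1) ^ 2) ≤
      c * x.length * (300 * (2 * s + 1) ^ 2) := Nat.mul_le_mul_right _ (by omega)
  have h3 : syndromeLength s (syndromeLength s x.length) * (46 * s + 50) ≤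
      c * x.length * (46 * s + 50) := Nat.mul_le_mul_right _ (by omega)
  have h4 : searchTime s * syndromeLength s x.length ^ (s + 2) ≤
      searchTime s * (syndromeFactor s ^ (s + 2) * x.length ^ (s + 2)) := by
    rw [← mul_pow]
    exact Nat.mul_le_mul_left _ (Nat.pow_le_pow_left h1 _)
  have h5 : x.length ≤ x.length ^ (s + 2) := Nat.le_self_pow (by omega) _
  have h6 := Nat.mul_le_mul_left (300 * (2 * s + 1) ^ 2 + c * (300 * (2 * s + 1) ^ 2) +
    c * (46 * s + 50) + 132) h5
  linarith

end WordRAM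

theorem mainTheorem8 (s : ℕ) :
    -- for every `n`, the code corrects one deletion and `s` substitutions
    (∀ n : ℕ, DelSub.IsCorrecting 1 s (DelSub.code s n)) ∧
    -- all codewords have a common length `N n`, and the redundancy is as claimed
    (∃ N : ℕ → ℕ,
      (∀ n : ℕ, ∀ c ∈ DelSub.code s n, c.length = N n) ∧
      (fun n : ℕ => DelSub.redundancy 2 (N n) (DelSub.code s n) -
          ((s : ℝ) + 1) * (2 * (s : ℝ) + 1) * Real.logb 2 (n : ℝ))
        =O[Filter.atTop] (fun n : ℕ => Real.logb 2 (Real.logb 2 (n : ℝ)))) ∧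
    -- encoding takes `O(n)` steps on a word RAM with words of `O(log n)` bits
    (∃ (p : WordRAM.Program) (a K : ℕ), ∀ n : ℕ, 1 ≤ n → ∀ x : List Bool, x.length = n →
      WordRAM.RunsIn p (a * (Nat.log 2 n + 1)) n x (DelSub.encode s x) (K * n)) ∧
    -- decoding takes `O(n ^ (s + 2))` steps on a word RAM with words of `O(log n)` bits
    (∃ (p : WordRAM.Program) (a K : ℕ), ∀ n : ℕ, 1 ≤ n → ∀ x : List Bool, x.length = n →
      ∀ y ∈ DelSub.ball 1 s (DelSub.encode s x),
        WordRAM.RunsIn p (a * (Nat.log 2 n + 1)) n y x (K * n ^ (s + 2))) := by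
  refine ⟨DelSub.isCorrecting_code s, ⟨DelSub.codeLength s, ?_, DelSub.redundancy_isBigO s⟩,
    WordRAM.exists_encodeProgram s, WordRAM.exists_decodeProgram s⟩
  rintro n _ ⟨x, rfl, rfl⟩
  exact DelSub.length_encode s x
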